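/- **Lemma (Sequence Stability).** Let $G$ be an additive abelian group, finite or infinite. For $X\subseteq G$ write $\overline{X}=G\setminus X$ and $-X=\{-x : x\in X\}$, and let $[X]$ (the closure of $X$) be the smallest coset of a subgroup of $G$ that contains $X$. *Trios.* A trio is a triple $(A,B,C)$ of subsets of $G$, each finite or cofinite, with $0\notin A+B+C$. Its deficiency is $\ell+m-n$, where $n$ is the size of the complement of the largest of the three sets and $\ell,m$ are the sizes of the other two; the trio is critical if its deficiency is positive. It is maximal if the only trio $(A^*,B^*,C^*)$ with $A\subseteq A^*$, $B\subseteq B^*$, $C\subseteq C^*$ is $(A,B,C)$ itself. Two trios are similar if one is obtained from the other by a finite sequence of permutations of the three sets and of operations $(A,B,C)\mapsto(A+g,B-g,C)$ with $g\in G$. *Sequences.* Let $H<G$ be a finite proper subgroup and let $R\in G/H$ generate $G/H$ (so $G/H$ is cyclic). An $R$-sequence is a set of the form $\bigcup_{i=0}^{k}(D+iR)$ with $D\in G/H$ and $k\ge 0$; it is nontrivial if its length $k+1$ is at least $2$, and basic if its head $D$ is $H$. A set $A\subseteq G$ is a near $R$-sequence if $A+H$ is an $R$-sequence and $|(A+H)\setminus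 A|<|H|$; it is proper if $|\overline{A}|\ge 2|H|$. A proper near sequence is a proper near $R$-sequence for some such $H$ and $R$. *Chords.* A trio $\Upsilon$ is a pure chord relative to a finite proper subgroup $H<G$ if there are a generator $R\in G/H$ of $G/H$ and a trio $(A,B,C)$ similar to $\Upsilon$ such that $A$ and $B$ are nontrivial $R$-sequences and $C=\overline{-(A+B)}$ is not contained in a single $H$-coset. It is an impure chord relative to $H$ if there are a generator $R\in G/H$ of $G/H$ and a trio $(A,B,C)$ similar to $\Upsilon$ such that $H\cup A$ and $H\cup B$ are nontrivial basic $R$-sequences, $C\setminus H=\overline{-(A+B)}\setminus H\neq\emptyset$, and $A\cap H$, $B\cap H$, $C\cap H$ are all nonempty. A trio is a pure (respectively impure) chord if it is one relative to some finite proper subgroup of $G$. *Claim.* Let $(A,B,C)$ be a maximal critical trio in $G$ with $[A]=[B]=[C]=G$. If $A$ is a proper near sequence, then $(A,B,C)$ is a pure chord or an impure chord. -/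

import Mathlib

open scoped Pointwise

/-- `(A, B, C)` is a trio: `0 ∉ A + B + C` and each of the three sets is finite or cofinite. -/
def IsTrio {G : Type*} [AddCommGroup G] (A B C : Set G) : Prop :=
  (0 : G) ∉ A + B + C ∧
    (A.Finite ∨ Aᶜ.Finite) ∧ (B.Finite ∨ Bᶜ.Finite) ∧ (C.Finite ∨ Cᶜ.Finite)

open Classical in
/-- The deficiency `ℓ + m - n`, where `n` is the size of the complement of the largest of the three
sets and `ℓ`, `m` are the sizes of the other two. For a trio the largest set is cofinite or
all three sets are finite, so `∞ - ∞` never occurs; the value is `-∞` exactly when `G` is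
infinite and all three sets are finite. -/
noncomputable def trioDeficiency {G : Type*} [AddCommGroup G] (A B C : Set G) : EReal :=
  if A.encard ≤ C.encard ∧ B.encard ≤ C.encard then
    (A.encard : EReal) + (B.encard : EReal) - (Cᶜ.encard : EReal)
  else if A.encard ≤ B.encard ∧ C.encard ≤ B.encard then
    (A.encard : EReal) + (C.encard : EReal) - (Bᶜ.encard : EReal)
  else
    (B.encard : EReal) + (C.encard : EReal) - (Aᶜ.encard : EReal)

/-- A trio is critical if its deficiency is positive. -/
def IsCriticalTrio {G : Type*} [AddCommGroup G] (A B C : Set G) : Prop :=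
  IsTrio A B C ∧ 0 < trioDeficiency A B C

/-- A trio is maximal if its only supertrio is itself. -/
def IsMaximalTrio {G : Type*} [AddCommGroup G] (A B C : Set G) : Prop :=
  IsTrio A B C ∧
    ∀ A' B' C' : Set G, IsTrio A' B' C' → A ⊆ A' → B ⊆ B' → C ⊆ C' →
      A' = A ∧ B' = B ∧ C' = C

/-- The closure `[A]`: the smallest coset (of any subgroup) that contains `A`. -/
def cosetClosure {G : Type*} [AddCommGroup G] (A : Set G) : Set G :=
  ⋂₀ {S : Set G | A ⊆ S ∧ ∃ (K : AddSubgroup G) (g : G), S = g +ᵥ (K : Set G)}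

/-- One elementary operation on triples of sets: a transposition of two neighbouring entries
(these generate all permutations), or `(A, B, C) ↦ (A + g, B - g, C)`. -/
inductive TrioMove {G : Type*} [AddCommGroup G] :
    Set G × Set G × Set G → Set G × Set G × Set G → Prop
  | swapLeft (A B C : Set G) : TrioMove (A, B, C) (B, A, C)
  | swapRight (A B C : Set G) : TrioMove (A, B, C) (A, C, B)
  | shift (g : G) (A B C : Set G) : TrioMove (A, B, C) (g +ᵥ A, (-g) +ᵥ B, C)

/-- Two triples are similar if one is turned into the other by a finite sequence of moves. -/
def TrioSimilar {G : Type*} [AddCommGroup G] (A B C A' B' C' : Set G) : Prop :=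
  Relation.ReflTransGen TrioMove (A, B, C) (A', B', C')

/-- The union of the `k + 1` cosets `D, D + R, …, D + kR` of `H`. -/
def cosetRun {G : Type*} [AddCommGroup G] {H : AddSubgroup G} (D R : G ⧸ H) (k : ℕ) : Set G :=
  {x : G | ∃ i : ℕ, i ≤ k ∧ (QuotientAddGroup.mk x : G ⧸ H) = D + i • R}

/-- The standing assumptions on `H` and `R`: `H` is a finite proper subgroup, and the coset `R`
generates `G / H` (which is therefore cyclic). -/
def IsGeneratingCoset {G : Type*} [AddCommGroup G] (H : AddSubgroup G) (R : G ⧸ H) : Prop :=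
  (H : Set G).Finite ∧ H < ⊤ ∧ AddSubgroup.zmultiples R = ⊤

/-- `S` is an `R`-sequence. -/
def IsCosetSeq {G : Type*} [AddCommGroup G] {H : AddSubgroup G} (R : G ⧸ H) (S : Set G) : Prop :=
  ∃ (D : G ⧸ H) (k : ℕ), S = cosetRun D R k

/-- `S` is a nontrivial `R`-sequence: an `R`-sequence of length at least `2`. -/
def IsNontrivialCosetSeq {G : Type*} [AddCommGroup G] {H : AddSubgroup G} (R : G ⧸ H)
    (S : Set G) : Prop :=
  ∃ (D : G ⧸ H) (k : ℕ), 2 ≤ k + 1 ∧ S = cosetRun D R k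

/-- `S` is a nontrivial basic `R`-sequence: its length is at least `2` and its head is `H`. -/
def IsNontrivialBasicCosetSeq {G : Type*} [AddCommGroup G] {H : AddSubgroup G} (R : G ⧸ H)
    (S : Set G) : Prop :=
  ∃ k : ℕ, 2 ≤ k + 1 ∧ S = cosetRun 0 R k

/-- `A` is a near `R`-sequence. -/
def IsNearCosetSeq {G : Type*} [AddCommGroup G] {H : AddSubgroup G} (R : G ⧸ H)
    (A : Set G) : Prop :=
  IsCosetSeq R (A + (H : Set G)) ∧ ((A + (H : Set G)) \ A).encard < (H : Set G).encard

/-- `A` is a proper near `R`-sequence: moreover its complement has at least `2|H|` elements. -/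
def IsProperNearCosetSeq {G : Type*} [AddCommGroup G] {H : AddSubgroup G} (R : G ⧸ H)
    (A : Set G) : Prop :=
  IsNearCosetSeq R A ∧ 2 * (H : Set G).encard ≤ Aᶜ.encard

/-- The trio `(X, Y, Z)` is a pure chord relative to `H`. -/
def IsPureChord {G : Type*} [AddCommGroup G] (H : AddSubgroup G) (X Y Z : Set G) : Prop :=
  IsTrio X Y Z ∧
    ∃ R : G ⧸ H, IsGeneratingCoset H R ∧
      ∃ A B C : Set G, IsTrio A B C ∧ TrioSimilar X Y Z A B C ∧
        IsNontrivialCosetSeq R A ∧ IsNontrivialCosetSeq R B ∧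
        C = (-(A + B))ᶜ ∧ ¬ ∃ g : G, C ⊆ g +ᵥ (H : Set G)

/-- The trio `(X, Y, Z)` is an impure chord relative to `H`. -/
def IsImpureChord {G : Type*} [AddCommGroup G] (H : AddSubgroup G) (X Y Z : Set G) : Prop :=
  IsTrio X Y Z ∧
    ∃ R : G ⧸ H, IsGeneratingCoset H R ∧
      ∃ A B C : Set G, IsTrio A B C ∧ TrioSimilar X Y Z A B C ∧
        IsNontrivialBasicCosetSeq R ((H : Set G) ∪ A) ∧
        IsNontrivialBasicCosetSeq R ((H : Set G) ∪ B) ∧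
        C \ (H : Set G) = (-(A + B))ᶜ \ (H : Set G) ∧ (C \ (H : Set G)).Nonempty ∧
        (A ∩ (H : Set G)).Nonempty ∧ (B ∩ (H : Set G)).Nonempty ∧ (C ∩ (H : Set G)).Nonempty

/-! Write `A + H` as a run of `a` cosets of `H`; `a ≥ 2` because `[A] = G`. Cut `A`, `B`, `C` into
fibres over the cyclic group `G / H`, each translated into `H`. All fibres of `A` together miss
fewer than `|H|` elements (the holes), so a fibre of `A` plus a fibre of `B` with more elements than
the first has holes is a whole coset.

Suppose first that `A + B` misses some coset. Then the support of `B` avoids an arc of length `a`,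
so both supports lie on a path without wrap-around, and criticality reads `|A + B| < |A| + |B|`.
Double counting along the path (`LinearPair.full_inner`, `LinearPair.full_end`) shows that every
coset of the sumset's run is full except possibly one at an end. Maximality then fills up `A` and
`B`: the trio is a pure chord if both ends are full and an impure chord otherwise
(`chord_of_linear`). The same applies with `B` and `C` exchanged, and in an infinite group one of
the two exchanges always applies.

What is left is a finite group in which both `A + B` and `A + C` meet every coset. This is
impossible (`CoverData.elim`). If for some nonempty fibre of one of `B`, `C` that fibre and the `a`
opposite fibres of the other set have total size at most `|H|`, discarding them leaves a linear
configuration, whose conclusion contradicts the covering. If no such fibre exists, the supports have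
so many periods that only small parameters survive, and a count excludes those. Properness of `A`
enters here: it leaves at least two cosets outside `A + H`. -/

/-! ### Sumsets of small cardinality in an abelian group. -/

section SmallSumset

variable {Γ : Type*} [AddCommGroup Γ] [DecidableEq Γ]

/-- The number of representations of `d` as a difference of two elements of `Z`. -/
def diffCount (Z : Finset Γ) (d : Γ) : ℕ := (Z.filter (fun x => x - d ∈ Z)).card

/-- The translates `y₁ + Z` and `y₂ + Z` both lie in `Y + Z`, and their overlap is counted by the
representations of `y₁ - y₂`. -/
theorem two_mul_card_le_add_diffCount {Y : Finset Γ} (Z : Finset Γ) {y₁ y₂ : Γ}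
    (h₁ : y₁ ∈ Y) (h₂ : y₂ ∈ Y) : 2 * Z.card ≤ (Y + Z).card + diffCount Z (y₁ - y₂) := by
  have e₁ : (Z.image (y₁ + ·)).card = Z.card :=
    Finset.card_image_of_injective _ (add_right_injective y₁)
  have e₂ : (Z.image (y₂ + ·)).card = Z.card :=
    Finset.card_image_of_injective _ (add_right_injective y₂)
  have hu : Z.image (y₁ + ·) ∪ Z.image (y₂ + ·) ⊆ Y + Z := by
    intro x hx
    simp only [Finset.mem_union, Finset.mem_image] at hx
    rcases hx with ⟨z, hz, rfl⟩ | ⟨z, hz, rfl⟩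
    · exact Finset.add_mem_add h₁ hz
    · exact Finset.add_mem_add h₂ hz
  have hi : Z.image (y₁ + ·) ∩ Z.image (y₂ + ·) ⊆
      (Z.filter (fun x => x - (y₁ - y₂) ∈ Z)).image (y₂ + ·) := by
    intro x hx
    simp only [Finset.mem_inter, Finset.mem_image] at hx
    obtain ⟨⟨z, hz, rfl⟩, w, hw, hwz⟩ := hx
    refine Finset.mem_image.2 ⟨w, Finset.mem_filter.2 ⟨hw, ?_⟩, hwz⟩
    have : w - (y₁ - y₂) = z := by
      have : w = y₁ + z - y₂ := by rw [← hwz]; abel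
      rw [this]; abel
    rwa [this]
  have h1 := Finset.card_le_card hu
  have h2 := (Finset.card_le_card hi).trans Finset.card_image_le
  have h3 := Finset.card_union_add_card_inter (Z.image (y₁ + ·)) (Z.image (y₂ + ·))
  unfold diffCount
  omega

theorem mem_sub_of_diffCount_pos {Z : Finset Γ} {d : Γ} (h : 0 < diffCount Z d) : d ∈ Z - Z := by
  obtain ⟨x, hx⟩ := Finset.card_pos.1 h
  rw [Finset.mem_filter] at hx
  exact Finset.mem_sub.2 ⟨x, hx.1, x - d, hx.2, by abel⟩

theorem sum_diffCount (Z : Finset Γ) : ∑ d ∈ Z - Z, diffCount Z d = Z.card * Z.card := by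
  rw [← Finset.card_product, Finset.card_eq_sum_card_fiberwise (f := fun q : Γ × Γ => q.1 - q.2)
    (t := Z - Z) (fun q hq => by
      have := Finset.mem_product.1 (Finset.mem_coe.1 hq)
      exact Finset.mem_coe.2 (Finset.sub_mem_sub this.1 this.2))]
  refine Finset.sum_congr rfl fun d _ => ?_
  unfold diffCount
  refine Finset.card_bij (fun x _ => (x, x - d)) ?_ ?_ ?_
  · intro x hx
    rw [Finset.mem_filter] at hx
    simp [hx.1, hx.2]
  · intro x _ y _ hxy
    exact (Prod.ext_iff.1 hxy).1
  · rintro ⟨x, y⟩ hq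
    simp only [Finset.mem_filter, Finset.mem_product] at hq
    refine ⟨x, Finset.mem_filter.2 ⟨hq.1.1, ?_⟩, ?_⟩
    · rw [← hq.2]; simpa using hq.1.2
    · rw [← hq.2]; simp

/-- Small doubling forces `Y - Y = Z - Z`, and every difference has more than `2/3 |Z|`
representations in `Z`. Two such sets of representations intersect, so `Z - Z` is a subgroup;
counting pairs gives it fewer than `3/2 |Z|` elements, and `Y + Z` is one of its cosets. -/
theorem exists_addSubgroup_card_of_card_add_lt_aux {Y Z : Finset Γ} (hY : Y.Nonempty)
    (hZ : Z.Nonempty) (hYZ : Y.card ≤ Z.card)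
    (h : 3 * (Y + Z).card < 2 * (Y.card + Z.card)) :
    ∃ L : AddSubgroup Γ, (Y + Z).card = Nat.card L := by
  have hZs : Z.card ≤ (Y + Z).card := Finset.card_le_card_add_left hY
  obtain ⟨y₀, hy₀⟩ := hY
  obtain ⟨z₀, hz₀⟩ := hZ
  have hD : Y - Y ⊆ Z - Z := by
    intro d hd
    obtain ⟨y, hy, y', hy', rfl⟩ := Finset.mem_sub.1 hd
    have := two_mul_card_le_add_diffCount Z hy hy'
    exact mem_sub_of_diffCount_pos (by omega)
  have hD' : Z - Z ⊆ Y - Y := by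
    intro d hd
    obtain ⟨y, hy, y', hy', rfl⟩ := Finset.mem_sub.1 hd
    have := two_mul_card_le_add_diffCount Y hy hy'
    rw [add_comm Z Y] at this
    exact mem_sub_of_diffCount_pos (by omega)
  have hr : ∀ d ∈ Z - Z, 2 * Z.card ≤ (Y + Z).card + diffCount Z d := by
    intro d hd
    obtain ⟨y, hy, y', hy', rfl⟩ := Finset.mem_sub.1 (hD' hd)
    exact two_mul_card_le_add_diffCount Z hy hy'
  have hsub : ∀ d₁ ∈ Z - Z, ∀ d₂ ∈ Z - Z, d₂ - d₁ ∈ Z - Z := by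
    intro d₁ h₁ d₂ h₂
    have hc₁ := hr d₁ h₁
    have hc₂ := hr d₂ h₂
    unfold diffCount at hc₁ hc₂
    obtain ⟨x, hx⟩ := Finset.inter_nonempty_of_card_lt_card_add_card
      (Finset.filter_subset (fun x => x - d₁ ∈ Z) Z)
      (Finset.filter_subset (fun x => x - d₂ ∈ Z) Z) (by omega)
    simp only [Finset.mem_inter, Finset.mem_filter] at hx
    exact Finset.mem_sub.2 ⟨x - d₁, hx.1.2, x - d₂, hx.2.2, by abel⟩
  have hzero : (0 : Γ) ∈ Z - Z := Finset.mem_sub.2 ⟨z₀, hz₀, z₀, hz₀, sub_self _⟩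
  let L : AddSubgroup Γ := AddSubgroup.ofSub (↑(Z - Z) : Set Γ) ⟨0, Finset.mem_coe.2 hzero⟩ (by
    intro x hx y hy
    exact Finset.mem_coe.2 (by simpa [sub_eq_add_neg] using hsub y hy x hx))
  have hL : ∀ x, x ∈ L ↔ x ∈ Z - Z := fun x => Iff.rfl
  have hcard : Nat.card L = (Z - Z).card := by
    have : Nat.card L = Nat.card (↑(Z - Z) : Set Γ) := rfl
    rw [this, Nat.card_coe_set_eq, Set.ncard_coe_finset]
  refine ⟨L, ?_⟩
  rw [hcard]
  have hZpos : 0 < Z.card := Finset.card_pos.2 ⟨z₀, hz₀⟩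
  have hlt : 2 * (Z - Z).card < 3 * Z.card := by
    have h1 : (Z - Z).card * (2 * Z.card - (Y + Z).card) ≤ Z.card * Z.card := by
      rw [← sum_diffCount]
      exact Finset.card_nsmul_le_sum _ _ _ (fun d hd => by have := hr d hd; omega)
    by_contra hcon
    have h2 : 2 * Z.card < 3 * (2 * Z.card - (Y + Z).card) := by omega
    nlinarith
  apply le_antisymm
  · have : Y + Z ⊆ (Z - Z).image (y₀ + z₀ + ·) := by
      intro x hx
      obtain ⟨y, hy, z, hz, rfl⟩ := Finset.mem_add.1 hx
      refine Finset.mem_image.2 ⟨(y - y₀) + (z - z₀), ?_, by abel⟩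
      exact L.add_mem ((hL _).2 (hD (Finset.sub_mem_sub hy hy₀)))
        ((hL _).2 (Finset.sub_mem_sub hz hz₀))
    exact (Finset.card_le_card this).trans Finset.card_image_le
  · have : (Z - Z).image (y₀ + z₀ + ·) ⊆ Y + Z := by
      intro w hw
      obtain ⟨x, hx, rfl⟩ := Finset.mem_image.1 hw
      have i₁ : Y ⊆ (Z - Z).image (y₀ + ·) := fun y hy =>
        Finset.mem_image.2 ⟨y - y₀, hD (Finset.sub_mem_sub hy hy₀), by abel⟩
      have i₂ : Z.image (fun z => y₀ + z₀ + x - z) ⊆ (Z - Z).image (y₀ + ·) := by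
        intro v hv
        obtain ⟨z, hz, rfl⟩ := Finset.mem_image.1 hv
        refine Finset.mem_image.2 ⟨x - (z - z₀), ?_, by abel⟩
        exact L.sub_mem ((hL _).2 hx) ((hL _).2 (Finset.sub_mem_sub hz hz₀))
      have c₁ : ((Z - Z).image (y₀ + ·)).card = (Z - Z).card :=
        Finset.card_image_of_injective _ (add_right_injective y₀)
      have c₂ : (Z.image (fun z => y₀ + z₀ + x - z)).card = Z.card :=
        Finset.card_image_of_injective _ (sub_right_injective)
      -- `Y` and `w - Z` lie in the same coset of `Z - Z` and are jointly larger than it, so they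
      -- meet and `w ∈ Y + Z`.
      obtain ⟨v, hv⟩ := Finset.inter_nonempty_of_card_lt_card_add_card i₁ i₂ (by omega)
      rw [Finset.mem_inter, Finset.mem_image] at hv
      obtain ⟨hv, z, hz, rfl⟩ := hv
      exact Finset.mem_add.2 ⟨_, hv, z, hz, by abel⟩
    rw [← Finset.card_image_of_injective (Z - Z) (add_right_injective (y₀ + z₀))]
    exact Finset.card_le_card this

/-- If `|Y + Z| < 2/3 (|Y| + |Z|)`, then `|Y + Z|` is the order of a subgroup. -/
theorem exists_addSubgroup_card_of_card_add_lt {Y Z : Finset Γ} (hY : Y.Nonempty)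
    (hZ : Z.Nonempty) (h : 3 * (Y + Z).card < 2 * (Y.card + Z.card)) :
    ∃ L : AddSubgroup Γ, (Y + Z).card = Nat.card L := by
  rcases le_total Y.card Z.card with hle | hle
  · exact exists_addSubgroup_card_of_card_add_lt_aux hY hZ hle h
  · rw [add_comm Y Z] at h ⊢
    exact exists_addSubgroup_card_of_card_add_lt_aux hZ hY hle (by omega)

variable [Fintype Γ]

/-- Bounds on `|Y| + |Z|` for nonempty `Y`, `Z` whose sumset has at most `h` elements. -/
theorem card_add_card_bounds {Y Z : Finset Γ} (hY : Y.Nonempty) (hZ : Z.Nonempty) {h : ℕ}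
    (hs : (Y + Z).card ≤ h) :
    (2 * h < Fintype.card Γ → 2 * (Y.card + Z.card) ≤ Fintype.card Γ + h) ∧
    (3 * h < Fintype.card Γ → 2 * (Y.card + Z.card) ≤ Fintype.card Γ) := by
  have hYs : Y.card ≤ (Y + Z).card := Finset.card_le_card_add_right hZ
  have hZs : Z.card ≤ (Y + Z).card := Finset.card_le_card_add_left hY
  by_cases hc : 3 * (Y + Z).card < 2 * (Y.card + Z.card)
  · obtain ⟨L, hL⟩ := exists_addSubgroup_card_of_card_add_lt hY hZ hc
    obtain ⟨q, hq⟩ := L.card_addSubgroup_dvd_card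
    rw [Nat.card_eq_fintype_card, ← hL] at hq
    have hpos : 0 < (Y + Z).card := Finset.card_pos.2 (hY.add hZ)
    constructor
    · intro h2
      -- The order of the subgroup properly divides `|Γ|`, so the hypothesis on `h` bounds the index
      -- below; the claim follows from `|Y|, |Z| ≤ |Y + Z|`.
      have : 3 ≤ q := by
        by_contra hq3
        have : q ≤ 2 := by omega
        nlinarith
      nlinarith
    · intro h3
      have : 4 ≤ q := by
        by_contra hq3
        have : q ≤ 3 := by omega
        nlinarith
      nlinarith
  · constructor <;> intro _ <;> omega

theorem mem_add_of_card_lt {X Y : Finset Γ} (h : Fintype.card Γ < X.card + Y.card) (g : Γ) :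
    g ∈ X + Y := by
  have c : (Y.image (fun y => g - y)).card = Y.card :=
    Finset.card_image_of_injective _ sub_right_injective
  obtain ⟨v, hv⟩ := Finset.inter_nonempty_of_card_lt_card_add_card (Finset.subset_univ X)
    (Finset.subset_univ (Y.image (fun y => g - y))) (by rw [c, Finset.card_univ]; exact h)
  rw [Finset.mem_inter, Finset.mem_image] at hv
  obtain ⟨hv, y, hy, rfl⟩ := hv
  exact Finset.mem_add.2 ⟨_, hv, y, hy, by abel⟩

theorem card_add_card_le_of_zero_notMem {X Y : Finset Γ} {g : Γ}
    (h : ∀ x ∈ X, ∀ y ∈ Y, x + y ≠ g) : X.card + Y.card ≤ Fintype.card Γ := by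
  by_contra hc
  obtain ⟨x, hx, y, hy, hxy⟩ := Finset.mem_add.1 (mem_add_of_card_lt (not_le.1 hc) g)
  exact h x hx y hy hxy

/-- Size restrictions on three nonempty subsets of a finite group with `0 ∉ X + Y + Z`. -/
theorem zero_free_card_bounds {X Y Z : Finset Γ} (hX : X.Nonempty) (hY : Y.Nonempty)
    (hZ : Z.Nonempty) (h : ∀ x ∈ X, ∀ y ∈ Y, ∀ z ∈ Z, x + y + z ≠ 0) :
    Y.card ≤ Fintype.card Γ - X.card ∧ Z.card ≤ Fintype.card Γ - X.card ∧
    Y.card + Z.card ≤ Fintype.card Γ ∧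
    (2 * (Fintype.card Γ - X.card) < Fintype.card Γ →
      2 * (Y.card + Z.card) ≤ Fintype.card Γ + (Fintype.card Γ - X.card)) ∧
    (3 * (Fintype.card Γ - X.card) < Fintype.card Γ →
      2 * (Y.card + Z.card) ≤ Fintype.card Γ) := by
  have hs : (Y + Z).card ≤ Fintype.card Γ - X.card := by
    have : X.card + (Y + Z).card ≤ Fintype.card Γ := by
      refine card_add_card_le_of_zero_notMem (g := 0) fun x hx w hw => ?_
      obtain ⟨y, hy, z, hz, rfl⟩ := Finset.mem_add.1 hw
      rw [← add_assoc]
      exact h x hx y hy z hz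
    omega
  have hYs : Y.card ≤ (Y + Z).card := Finset.card_le_card_add_right hZ
  have hZs : Z.card ≤ (Y + Z).card := Finset.card_le_card_add_left hY
  refine ⟨hYs.trans hs, hZs.trans hs, ?_, card_add_card_bounds hY hZ hs⟩
  obtain ⟨x, hx⟩ := hX
  refine card_add_card_le_of_zero_notMem (g := -x) fun y hy z hz hyz => ?_
  exact h x hx y hy z hz (by rw [add_assoc, hyz, add_neg_cancel])

/-- If `|X| > |Γ| / 2`, `Y` is nonempty and `|X| + |Y| ≤ |Γ|`, then
`|X + Y| ≥ |Y| + |X| / 2`. -/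
theorem card_le_two_mul_card_add_sub {X Y : Finset Γ} (hX : Fintype.card Γ < 2 * X.card)
    (hY : Y.Nonempty) (hXY : X.card + Y.card ≤ Fintype.card Γ) :
    X.card + 2 * Y.card ≤ 2 * (X + Y).card := by
  have hXne : X.Nonempty := by
    rw [← Finset.card_pos]; omega
  -- `Z` is the largest set with `0 ∉ X + Y + Z`, which turns the lower bound on `X + Y` into an
  -- upper bound on `|Y| + |Z|`.
  let Z : Finset Γ := (Finset.univ \ (X + Y)).image (fun x => -x)
  have hZc : Z.card = Fintype.card Γ - (X + Y).card := by
    rw [Finset.card_image_of_injective _ neg_injective, Finset.card_univ_sdiff]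
  have hle : (X + Y).card ≤ Fintype.card Γ := Finset.card_le_univ _
  by_cases hZ : Z.Nonempty
  · have := (zero_free_card_bounds hXne hY hZ (by
      intro x hx y hy z hz
      obtain ⟨w, hw, rfl⟩ := Finset.mem_image.1 hz
      rw [Finset.mem_sdiff] at hw
      intro h0
      apply hw.2
      rw [add_neg_eq_zero] at h0
      rw [← h0]
      exact Finset.add_mem_add hx hy)).2.2.2.1
    have := this (by omega)
    omega
  · rw [Finset.not_nonempty_iff_eq_empty] at hZ
    rw [hZ, Finset.card_empty] at hZc
    omega

end SmallSumset

/-! ### Sums and thresholds over the natural numbers. -/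

theorem add_le_sum_range_of_ne {a i j : ℕ} (h : ℕ → ℕ) (hi : i < a) (hj : j < a) (hij : i ≠ j) :
    h i + h j ≤ ∑ x ∈ Finset.range a, h x := by
  rw [← Finset.sum_pair hij]
  refine Finset.sum_le_sum_of_subset fun x hx => ?_
  rw [Finset.mem_insert, Finset.mem_singleton] at hx
  rcases hx with rfl | rfl <;> simpa

theorem le_sum_range {a i : ℕ} (h : ℕ → ℕ) (hi : i < a) :
    h i ≤ ∑ x ∈ Finset.range a, h x :=
  Finset.single_le_sum (f := h) (fun _ _ => Nat.zero_le _) (Finset.mem_range.2 hi)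

/-- Since `g ≤ f` termwise, all terms but one can be cancelled from the strict inequality. -/
theorem add_lt_add_of_sum_add_lt {s : Finset ℕ} {f g : ℕ → ℕ} {c d x : ℕ}
    (hfg : ∀ y ∈ s, g y ≤ f y) (hx : x ∈ s) (h : ∑ y ∈ s, f y + c < ∑ y ∈ s, g y + d) :
    f x + c < g x + d := by
  rw [← Finset.add_sum_erase s f hx, ← Finset.add_sum_erase s g hx] at h
  have : ∑ y ∈ s.erase x, g y ≤ ∑ y ∈ s.erase x, f y :=
    Finset.sum_le_sum fun y hy => hfg y (Finset.mem_of_mem_erase hy)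
  omega

theorem exists_step_down {P : ℕ → Prop} {j : ℕ} (h0 : P 0) (hj : ¬ P j) :
    ∃ k < j, P k ∧ ¬ P (k + 1) := by
  by_contra hcon
  push Not at hcon
  have : ∀ k ≤ j, P k := by
    intro k
    induction k with
    | zero => exact fun _ => h0
    | succ k ih => exact fun hk => hcon k (by omega) (ih (by omega))
  exact hj (this j le_rfl)

theorem exists_step_up {P : ℕ → Prop} {j m : ℕ} (hjm : j ≤ m) (hj : ¬ P j) (hm : P m) :
    ∃ k < m, ¬ P k ∧ P (k + 1) := by
  by_contra hcon
  push Not at hcon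
  have : ∀ k, j + k ≤ m → ¬ P (j + k) := by
    intro k
    induction k with
    | zero => exact fun _ => hj
    | succ k ih => exact fun hk => hcon (j + k) (by omega) (ih (by omega))
  exact this (m - j) (by omega) (by rwa [Nat.add_sub_cancel' hjm])

/-! ### Fibres arranged along a path. -/

section Linear

variable {Γ : Type*} [AddCommGroup Γ] [DecidableEq Γ] [Fintype Γ]

/-- Fibres `A i` (`i < a`), `B j` (`j ≤ m`) of two sets over a path, together with fibres `M e`
containing those of the sumset; `A` has fewer than `|Γ|` holes in total, and `B` is properly
supported on `[0, m]`. The total size of the `M e` is less than that of `A` and `B`. -/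
structure LinearPair (a m : ℕ) (A B M : ℕ → Finset Γ) : Prop where
  two_le : 2 ≤ a
  one_le : 1 ≤ m
  holes : ∑ i ∈ Finset.range a, (Fintype.card Γ - (A i).card) < Fintype.card Γ
  head : (B 0).Nonempty
  last : (B m).Nonempty
  sub : ∀ i < a, ∀ j ≤ m, A i + B j ⊆ M (i + j)
  small : ∑ e ∈ Finset.range (a + m), (M e).card <
    ∑ i ∈ Finset.range a, (A i).card + ∑ j ∈ Finset.range (m + 1), (B j).card

namespace LinearPair

variable {a m : ℕ} {A B M : ℕ → Finset Γ}

theorem nonempty_left (H : LinearPair a m A B M) {i : ℕ} (hi : i < a) : (A i).Nonempty := by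
  have h1 := le_sum_range (fun i => Fintype.card Γ - (A i).card) hi
  have h2 := H.holes
  rw [← Finset.card_pos]
  omega

theorem left_le (H : LinearPair a m A B M) {i j : ℕ} (hi : i < a) (hj : j ≤ m)
    (hB : (B j).Nonempty) : (A i).card ≤ (M (i + j)).card :=
  (Finset.card_le_card_add_right hB).trans (Finset.card_le_card (H.sub i hi j hj))

theorem right_le (H : LinearPair a m A B M) {i j : ℕ} (hi : i < a) (hj : j ≤ m) :
    (B j).card ≤ (M (i + j)).card :=
  (Finset.card_le_card_add_left (H.nonempty_left hi)).trans (Finset.card_le_card (H.sub i hi j hj))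

theorem full (H : LinearPair a m A B M) {i j : ℕ} (hi : i < a) (hj : j ≤ m)
    (h : Fintype.card Γ - (A i).card < (B j).card) : M (i + j) = Finset.univ := by
  refine Finset.eq_univ_iff_forall.2 fun g => H.sub i hi j hj (mem_add_of_card_lt ?_ g)
  omega

/-- Outside the positions `i, …, i + m`, the fibres of `M` are at least as large as the remaining
fibres of `A`: those before `i` through `B 0`, those after `i` through `B m`. Cancel both in
`small`. -/
theorem column (H : LinearPair a m A B M) {i : ℕ} (hi : i < a) :
    ∑ j ∈ Finset.range (m + 1), (M (i + j)).card <
      (A i).card + ∑ j ∈ Finset.range (m + 1), (B j).card := by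
  obtain ⟨b, rfl⟩ : ∃ b, a = i + 1 + b := ⟨a - (i + 1), by omega⟩
  have hs := H.small
  have e1 : i + 1 + b + m = i + (m + 1) + b := by omega
  rw [e1, Finset.sum_range_add, Finset.sum_range_add, Finset.sum_range_add (fun i => (A i).card),
    Finset.sum_range_succ (fun i => (A i).card)] at hs
  have h1 : ∑ x ∈ Finset.range i, (A x).card ≤ ∑ x ∈ Finset.range i, (M x).card :=
    Finset.sum_le_sum fun x hx => by
      have := Finset.mem_range.1 hx
      exact H.left_le (i := x) (j := 0) (by omega) (by omega) H.head
  have h2 : ∑ x ∈ Finset.range b, (A (i + 1 + x)).card ≤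
      ∑ x ∈ Finset.range b, (M (i + (m + 1) + x)).card :=
    Finset.sum_le_sum fun x hx => by
      have := Finset.mem_range.1 hx
      have h := H.left_le (i := i + 1 + x) (j := m) (by omega) le_rfl H.last
      rwa [show i + 1 + x + m = i + (m + 1) + x by omega] at h
  omega

theorem row (H : LinearPair a m A B M) {j : ℕ} (hj : j ≤ m) :
    ∑ e ∈ Finset.range j, (M e).card + ∑ i ∈ Finset.range a, (M (j + i)).card +
      ∑ x ∈ Finset.range (m - j), (M (j + a + x)).card <
    ∑ i ∈ Finset.range a, (A i).card + (∑ e ∈ Finset.range j, (B e).card + (B j).card +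
      ∑ x ∈ Finset.range (m - j), (B (j + 1 + x)).card) := by
  have hs := H.small
  rw [show a + m = j + a + (m - j) by omega, show m + 1 = j + 1 + (m - j) by omega,
    Finset.sum_range_add, Finset.sum_range_add, Finset.sum_range_add (fun i => (B i).card),
    Finset.sum_range_succ (fun i => (B i).card)] at hs
  exact hs

omit [AddCommGroup Γ] [DecidableEq Γ] in
theorem sum_left_add_holes (A : ℕ → Finset Γ) (a : ℕ) :
    ∑ i ∈ Finset.range a, (A i).card +
      ∑ i ∈ Finset.range a, (Fintype.card Γ - (A i).card) = a * Fintype.card Γ := by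
  rw [← Finset.sum_add_distrib, Finset.sum_congr rfl (g := fun _ => Fintype.card Γ)]
  · simp
  · intro i _
    have := Finset.card_le_univ (A i)
    omega

theorem nonempty_right (H : LinearPair a m A B M) {j : ℕ} (hj : j ≤ m) : (B j).Nonempty := by
  by_contra hj0
  obtain ⟨i₀, hi₀, hmin⟩ := Finset.exists_min_image (Finset.range a) (fun i => (A i).card)
    ⟨0, Finset.mem_range.2 (by have := H.two_le; omega)⟩
  rw [Finset.mem_range] at hi₀
  -- Take `k` at the border of a gap in the support of `B`. A neighbour of `i₀` plus the adjacent
  -- nonempty fibre of `B` lands at `i₀ + k`, and by the choice of `i₀` this alone contributes `|A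
  -- i₀|`, more than the column allows.
  obtain ⟨k, hk, hke, hkM⟩ : ∃ k ≤ m, ¬ (B k).Nonempty ∧ (A i₀).card ≤ (M (i₀ + k)).card := by
    by_cases hi : i₀ + 1 < a
    · obtain ⟨k, hk, h1, h2⟩ := exists_step_down (P := fun k => (B k).Nonempty) H.head hj0
      refine ⟨k + 1, by omega, h2, (hmin (i₀ + 1) (Finset.mem_range.2 hi)).trans ?_⟩
      have := H.left_le hi (j := k) (by omega) h1
      rwa [show i₀ + 1 + k = i₀ + (k + 1) by omega] at this
    · have hi1 : i₀ - 1 < a := by omega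
      have := H.two_le
      obtain ⟨k, hk, h1, h2⟩ := exists_step_up (P := fun k => (B k).Nonempty) hj hj0 H.last
      refine ⟨k, by omega, h1, (hmin (i₀ - 1) (Finset.mem_range.2 hi1)).trans ?_⟩
      have := H.left_le hi1 (j := k + 1) (by omega) h2
      rwa [show i₀ - 1 + (k + 1) = i₀ + k by omega] at this
  have hcol := H.column hi₀
  have hkr : k ∈ Finset.range (m + 1) := Finset.mem_range.2 (by omega)
  have := add_lt_add_of_sum_add_lt (c := 0) (d := (A i₀).card) (f := fun j => (M (i₀ + j)).card)
    (g := fun j => (B j).card) (fun y hy => H.right_le hi₀ (by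
      have := Finset.mem_range.1 hy; omega)) hkr (by omega)
  rw [Finset.not_nonempty_iff_eq_empty] at hke
  simp only [hke, Finset.card_empty] at this
  omega

/-- In a linear pair all inner fibres of the sumset are full. -/
theorem full_inner (H : LinearPair a m A B M) {e : ℕ} (he : 0 < e) (hem : e < a + m - 1) :
    M e = Finset.univ := by
  have ha := H.two_le
  have hm := H.one_le
  have hsum := sum_left_add_holes A a
  have hholes := H.holes
  have hcard : ∀ i, (A i).card + (Fintype.card Γ - (A i).card) = Fintype.card Γ := fun i => by
    have := Finset.card_le_univ (A i); omega
  have hpair : ∀ i < a, ∀ i' < a, i ≠ i' → (Fintype.card Γ - (A i).card) +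
      (Fintype.card Γ - (A i').card) ≤ ∑ i ∈ Finset.range a, (Fintype.card Γ - (A i).card) :=
    fun i hi i' hi' hne =>
      add_le_sum_range_of_ne (fun i => Fintype.card Γ - (A i).card) hi hi' hne
  -- `i₀` and `i₁` carry the largest and second largest number of holes; hence `A i₁` has fewer than
  -- `|Γ| / 2` holes.
  obtain ⟨i₀, hi₀, hmax₀⟩ := Finset.exists_max_image (Finset.range a)
    (fun i => Fintype.card Γ - (A i).card) ⟨0, Finset.mem_range.2 (by omega)⟩
  obtain ⟨i₁, hi₁, hmax₁⟩ := Finset.exists_max_image ((Finset.range a).erase i₀)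
    (fun i => Fintype.card Γ - (A i).card)
    ⟨if i₀ = 0 then 1 else 0, by
      rw [Finset.mem_erase, Finset.mem_range]; split_ifs <;> omega⟩
  rw [Finset.mem_erase, Finset.mem_range] at hi₁
  rw [Finset.mem_range] at hi₀
  have h01 := hpair i₀ hi₀ i₁ hi₁.2 hi₁.1.symm
  have h01' := hmax₀ i₁ (Finset.mem_range.2 hi₁.2)
  by_cases hC : ∀ j ≤ m, (B j).card ≤ Fintype.card Γ - (A i₁).card
  -- Each of the at least two entries of column `i₁` exceeds `|B j|` by at least `|A i₁| / 2`,
  -- contradicting `column`.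
  · exfalso
    have hcol := H.column hi₁.2
    have h1 : ∀ j ∈ Finset.range (m + 1),
        (A i₁).card + 2 * (B j).card ≤ 2 * (M (i₁ + j)).card := by
      intro j hj
      have hj' : j ≤ m := by have := Finset.mem_range.1 hj; omega
      have hb := hC j hj'
      have := hcard i₁
      have h2 := card_le_two_mul_card_add_sub (X := A i₁) (Y := B j) (by omega)
        (H.nonempty_right hj') (by omega)
      have h3 := Finset.card_le_card (H.sub i₁ hi₁.2 j hj')
      omega
    have h2 := Finset.sum_le_sum h1
    rw [Finset.sum_add_distrib, ← Finset.mul_sum, ← Finset.mul_sum, Finset.sum_const,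
      Finset.card_range, smul_eq_mul] at h2
    nlinarith
  · push Not at hC
    obtain ⟨j, hj, hBj⟩ := hC
    have hrow : ∀ i < a, i ≠ i₀ → M (i + j) = Finset.univ := by
      intro i hi hne
      refine H.full hi hj ?_
      have := hmax₁ i (by simp [hne, hi])
      omega
    have hr := H.row hj
    have hmid : (B j).card + (a - 1) * Fintype.card Γ ≤
        ∑ i ∈ Finset.range a, (M (j + i)).card := by
      rw [← Finset.add_sum_erase _ _ (Finset.mem_range.2 hi₀)]
      refine Nat.add_le_add ?_ ?_
      · rw [add_comm j]; exact H.right_le hi₀ hj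
      · rw [Finset.sum_congr rfl (g := fun _ => Fintype.card Γ)]
        · simp [Finset.card_erase_of_mem (Finset.mem_range.2 hi₀)]
        · intro i hi
          rw [Finset.mem_erase, Finset.mem_range] at hi
          rw [add_comm j, hrow i hi.2 hi.1, Finset.card_univ]
    have hap : a * Fintype.card Γ = (a - 1) * Fintype.card Γ + Fintype.card Γ := by
      obtain ⟨b, rfl⟩ : ∃ b, a = b + 1 := ⟨a - 1, by omega⟩
      simp [add_mul]
    have hL : ∀ y ∈ Finset.range j, (B y).card ≤ (M y).card := fun y hy => by
      have := Finset.mem_range.1 hy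
      simpa using H.right_le (i := 0) (j := y) (by omega) (by omega)
    have hR : ∀ y ∈ Finset.range (m - j), (B (j + 1 + y)).card ≤ (M (j + a + y)).card :=
      fun y hy => by
        have := Finset.mem_range.1 hy
        have h := H.right_le (i := a - 1) (j := j + 1 + y) (by omega) (by omega)
        rwa [show a - 1 + (j + 1 + y) = j + a + y by omega] at h
    have hL' := Finset.sum_le_sum hL
    have hR' := Finset.sum_le_sum hR
    -- Row `j` is full except perhaps at `i₀`, so little slack is left elsewhere: it forces `|B y|`
    -- to exceed all holes outside `A 0`, and thus the holes of every other `A i`. `fullR` is the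
    -- mirror image.
    have fullL : ∀ y < j, ∀ i < a, 0 < i → M (i + y) = Finset.univ := by
      intro y hy i hi hi0
      refine H.full hi (by omega) ?_
      have h1 := add_lt_add_of_sum_add_lt
        (c := ∑ i ∈ Finset.range a, (Fintype.card Γ - (A i).card)) (d := Fintype.card Γ)
        hL (Finset.mem_range.2 hy) (by omega)
      have h2 := H.left_le (i := 0) (j := y) (by omega) (by omega) (H.nonempty_right (by omega))
      rw [zero_add] at h2
      have h3 := hpair i hi 0 (by omega) (by omega)
      have h4 := hcard 0
      omega
    have fullR : ∀ y, j < y → y ≤ m → ∀ i < a - 1, M (i + y) = Finset.univ := by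
      intro y hy hym i hi
      refine H.full (by omega) hym ?_
      have h1 := add_lt_add_of_sum_add_lt
        (c := ∑ i ∈ Finset.range a, (Fintype.card Γ - (A i).card)) (d := Fintype.card Γ)
        hR (Finset.mem_range.2 (show y - (j + 1) < m - j by omega)) (by omega)
      have h2 := H.left_le (i := a - 1) (j := y) (by omega) hym (H.nonempty_right hym)
      rw [show j + 1 + (y - (j + 1)) = y by omega,
        show j + a + (y - (j + 1)) = a - 1 + y by omega] at h1
      have h3 := hpair i (by omega) (a - 1) (by omega) (by omega)
      have h4 := hcard (a - 1)
      omega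
    by_cases h1 : e < j
    · simpa [show 1 + (e - 1) = e by omega] using fullL (e - 1) (by omega) 1 (by omega) one_pos
    by_cases h2 : j + a - 1 < e
    · simpa [show a - 2 + (e - (a - 2)) = e by omega] using
        fullR (e - (a - 2)) (by omega) (by omega) (a - 2) (by omega)
    -- The one position that row `j` may miss is reached from the row above or below; one of them
    -- exists since `e` is not an end.
    by_cases h3 : e - j = i₀
    · by_cases h4 : 0 < i₀ ∧ j < m
      · simpa [show i₀ - 1 + (j + 1) = e by omega] using
          fullR (j + 1) (by omega) (by omega) (i₀ - 1) (by omega)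
      · simpa [show i₀ + 1 + (j - 1) = e by omega] using
          fullL (j - 1) (by omega) (i₀ + 1) (by omega) (by omega)
    · simpa [show e - j + j = e by omega] using hrow (e - j) (by omega) h3

/-- At least one of the two end fibres of the sumset is full. -/
theorem full_end (H : LinearPair a m A B M) :
    M 0 = Finset.univ ∨ M (a + m - 1) = Finset.univ := by
  by_contra hcon
  push Not at hcon
  have ha := H.two_le
  have hm := H.one_le
  -- If both ends fail, `B 0` and `B m` are bounded by holes of `A`. With all inner fibres full,
  -- `small` would then require at least `|Γ|` holes.
  have h0 : (B 0).card ≤ Fintype.card Γ - (A 0).card := by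
    by_contra h
    exact hcon.1 (by simpa using H.full (i := 0) (j := 0) (by omega) (by omega) (by omega))
  have h1 : (B m).card ≤ Fintype.card Γ - (A (a - 1)).card := by
    by_contra h
    exact hcon.2 (by
      simpa [show a - 1 + m = a + m - 1 by omega] using
        H.full (i := a - 1) (j := m) (by omega) (by omega) (by omega))
  have hM0 := H.left_le (i := 0) (j := 0) (by omega) (by omega) H.head
  have hM1 := H.left_le (i := a - 1) (j := m) (by omega) (by omega) H.last
  have hsum := sum_left_add_holes A a
  have hholes := H.holes
  have hpair := add_le_sum_range_of_ne (fun i => Fintype.card Γ - (A i).card) (a := a) (i := 0)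
    (j := a - 1) (by omega) (by omega) (by omega)
  have hc0 := Finset.card_le_univ (A 0)
  have hc1 := Finset.card_le_univ (A (a - 1))
  have hs := H.small
  have hin : ∀ e, 0 < e → e < a + m - 1 → M e = Finset.univ := fun e h h' => H.full_inner h h'
  obtain ⟨a, rfl⟩ : ∃ b, a = b + 2 := ⟨a - 2, by omega⟩
  obtain ⟨m, rfl⟩ : ∃ b, m = b + 1 := ⟨m - 1, by omega⟩
  rw [show a + 2 + (m + 1) = a + m + 1 + 1 + 1 by omega,
    Finset.sum_range_succ, Finset.sum_range_succ', Finset.sum_congr (g := fun _ => Fintype.card Γ)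
      rfl (fun e he => by
        have := Finset.mem_range.1 he
        rw [hin (e + 1) (by omega) (by omega), Finset.card_univ]),
    Finset.sum_range_succ (fun j => (B j).card) (m + 1),
    Finset.sum_range_succ' (fun j => (B j).card) m] at hs
  have hB : ∑ j ∈ Finset.range m, (B (j + 1)).card ≤ ∑ j ∈ Finset.range m, Fintype.card Γ :=
    Finset.sum_le_sum fun j _ => Finset.card_le_univ _
  simp only [Finset.sum_const, Finset.card_range, smul_eq_mul] at hs hB
  simp only [show a + 2 - 1 = a + 1 by omega, show a + 1 + (m + 1) = a + m + 2 by omega, zero_add] at *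
  have e1 : (a + m + 1) * Fintype.card Γ = a * Fintype.card Γ + m * Fintype.card Γ +
    Fintype.card Γ := by ring
  have e2 : (a + 2) * Fintype.card Γ = a * Fintype.card Γ + 2 * Fintype.card Γ := by ring
  omega

end LinearPair

end Linear

/-! ### Sums over a period. -/

theorem sum_range_add_of_periodic {f : ℤ → ℕ} {N : ℕ} (hf : ∀ x, f (x + N) = f x) (o : ℤ) :
    ∑ x ∈ Finset.range N, f (o + x) = ∑ x ∈ Finset.range N, f x := by
  have step : ∀ o : ℤ, ∑ x ∈ Finset.range N, f (o + 1 + x) = ∑ x ∈ Finset.range N, f (o + x) := by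
    intro o
    have h1 := Finset.sum_range_succ (fun x : ℕ => f (o + x)) N
    have h2 := Finset.sum_range_succ' (fun x : ℕ => f (o + x)) N
    have h3 : ∑ x ∈ Finset.range N, f (o + 1 + x) =
        ∑ x ∈ Finset.range N, f (o + ((x + 1 : ℕ) : ℤ)) :=
      Finset.sum_congr rfl fun x _ => by congr 1; push_cast; ring
    have h4 := hf o
    simp only [Nat.cast_zero, add_zero] at h2
    omega
  induction o using Int.induction_on with
  | zero => simp
  | succ i ih => rw [step, ih]
  | pred i ih => rw [← step, sub_add_cancel, ih]

/-- Splitting a period into `a` consecutive places ending at `o` and the `t` places after `o`. -/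
theorem sum_range_eq_window_add {f : ℤ → ℕ} {a t : ℕ} (hf : ∀ x, f (x + (a + t : ℕ)) = f x)
    (o : ℤ) : ∑ x ∈ Finset.range (a + t), f x =
      ∑ i ∈ Finset.range a, f (o - i) + ∑ y ∈ Finset.range t, f (o + 1 + y) := by
  rw [← sum_range_add_of_periodic hf (o + 1 - a), Finset.sum_range_add,
    ← Finset.sum_range_reflect (fun i : ℕ => f (o - i))]
  congr 1
  · refine Finset.sum_congr rfl fun x hx => ?_
    have := Finset.mem_range.1 hx
    congr 1
    omega
  · refine Finset.sum_congr rfl fun x _ => ?_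
    congr 1
    push_cast
    ring

theorem sum_range_reflect_of_periodic {f : ℤ → ℕ} {N : ℕ} (hf : ∀ x, f (x + N) = f x) (c : ℤ) :
    ∑ x ∈ Finset.range N, f (c - x) = ∑ x ∈ Finset.range N, f x := by
  have := sum_range_eq_window_add (a := N) (t := 0) hf c
  simpa using this.symm

/-! ### Numerical analysis of the case where all cosets are covered. -/

/-- The places `i < a` where the fibre of `f` opposite to `i` and `k` is nonempty. -/
def oppositeSupport (a : ℕ) (f : ℤ → ℕ) (k : ℤ) : Finset ℕ :=
  (Finset.range a).filter (fun i => 0 < f (-k - i))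

theorem mem_oppositeSupport {a : ℕ} {f : ℤ → ℕ} {k : ℤ} {i : ℕ} :
    i ∈ oppositeSupport a f k ↔ i < a ∧ 0 < f (-k - i) := by
  simp [oppositeSupport]

/-- Both sets consist of the places with the largest values of `h`, so they are nested. -/
theorem subset_of_card_le_of_upper {a : ℕ} {h : ℕ → ℕ} {S S' : Finset ℕ}
    (hS : S ⊆ Finset.range a) (hS' : S' ⊆ Finset.range a)
    (hu : ∀ i < a, i ∉ S → ∀ i' ∈ S, h i < h i')
    (hu' : ∀ i < a, i ∉ S' → ∀ i' ∈ S', h i < h i') (hc : S.card ≤ S'.card) : S ⊆ S' := by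
  intro i hi
  by_contra hi'
  have : ∃ i₂ ∈ S', i₂ ∉ S := by
    by_contra hcon
    push Not at hcon
    have hss : S' ⊂ S := Finset.ssubset_iff_subset_ne.2 ⟨hcon, by rintro rfl; exact hi' hi⟩
    have := Finset.card_lt_card hss
    omega
  obtain ⟨i₂, h2, h2'⟩ := this
  have h3 := hu i₂ (Finset.mem_range.1 (hS' h2)) h2' i hi
  have h4 := hu' i (Finset.mem_range.1 (hS hi)) hi' i₂ h2
  omega

/-- Fibre sizes `β`, `γ` of two sets over a cyclic group of order `a + t`, together with the
numbers `h i` of holes of a third set supported on `[0, a)`, under the assumption that the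
sumset of the third set with either of the other two meets all fibres. -/
structure CoverData (a t p : ℕ) (h : ℕ → ℕ) (β γ : ℤ → ℕ) : Prop where
  two_le_a : 2 ≤ a
  two_le_t : 2 ≤ t
  sum_lt : ∑ i ∈ Finset.range a, h i < p
  periodic_left : ∀ x, β (x + (a + t : ℕ)) = β x
  periodic_right : ∀ x, γ (x + (a + t : ℕ)) = γ x
  pair : ∀ i < a, ∀ j k : ℤ, i + j + k = 0 → 0 < β j → 0 < γ k →
    β j ≤ h i ∧ γ k ≤ h i ∧ β j + γ k ≤ p ∧ (2 * h i < p → 2 * (β j + γ k) ≤ p + h i) ∧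
      (3 * h i < p → 2 * (β j + γ k) ≤ p)
  cover_left : ∀ k, 0 < γ k → ∃ i < a, 0 < β (-k - i)
  cover_right : ∀ j, 0 < β j → ∃ i < a, 0 < γ (-j - i)
  crit : t * p + ∑ i ∈ Finset.range a, h i <
    ∑ x ∈ Finset.range (a + t), β x + ∑ x ∈ Finset.range (a + t), γ x

namespace CoverData

variable {a t p : ℕ} {h : ℕ → ℕ} {β γ : ℤ → ℕ}

theorem symm (D : CoverData a t p h β γ) : CoverData a t p h γ β where
  two_le_a := D.two_le_a
  two_le_t := D.two_le_t
  sum_lt := D.sum_lt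
  periodic_left := D.periodic_right
  periodic_right := D.periodic_left
  pair i hi j k hijk hj hk := by
    obtain ⟨h1, h2, h3, h4, h5⟩ := D.pair i hi k j (by omega) hk hj
    rw [add_comm (β k)] at h3 h4 h5
    exact ⟨h2, h1, h3, h4, h5⟩
  cover_left := D.cover_right
  cover_right := D.cover_left
  crit := by rw [add_comm (∑ x ∈ Finset.range (a + t), γ x)]; exact D.crit

theorem pair_support (D : CoverData a t p h β γ) {i : ℕ} {k : ℤ} (hk : 0 < γ k)
    (hi : i ∈ oppositeSupport a β k) :
    β (-k - i) ≤ h i ∧ γ k ≤ h i ∧ β (-k - i) + γ k ≤ p ∧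
      (2 * h i < p → 2 * (β (-k - i) + γ k) ≤ p + h i) ∧
      (3 * h i < p → 2 * (β (-k - i) + γ k) ≤ p) := by
  rw [mem_oppositeSupport] at hi
  exact D.pair i hi.1 _ _ (by ring) hi.2 hk

theorem support_nonempty (D : CoverData a t p h β γ) {k : ℤ} (hk : 0 < γ k) :
    (oppositeSupport a β k).Nonempty := by
  obtain ⟨i, hi, hb⟩ := D.cover_left k hk
  exact ⟨i, mem_oppositeSupport.2 ⟨hi, hb⟩⟩

theorem window_eq (a : ℕ) (β : ℤ → ℕ) (k : ℤ) : ∑ i ∈ Finset.range a, β (-k - i) =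
    ∑ i ∈ oppositeSupport a β k, β (-k - i) := by
  refine (Finset.sum_subset (Finset.filter_subset _ _) fun i hi hi' => ?_).symm
  by_contra h0
  exact hi' (mem_oppositeSupport.2 ⟨Finset.mem_range.1 hi, Nat.pos_of_ne_zero h0⟩)

theorem window_le (D : CoverData a t p h β γ) {k : ℤ} (hk : 0 < γ k) :
    ∑ i ∈ Finset.range a, β (-k - i) ≤ ∑ i ∈ oppositeSupport a β k, h i := by
  rw [window_eq]
  exact Finset.sum_le_sum fun i hi => (D.pair_support hk hi).1

theorem support_sum_le (a : ℕ) (h : ℕ → ℕ) (β : ℤ → ℕ) (k : ℤ) :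
    ∑ i ∈ oppositeSupport a β k, h i ≤ ∑ i ∈ Finset.range a, h i :=
  Finset.sum_le_sum_of_subset (Finset.filter_subset _ _)

theorem support_sum_add_le {i : ℕ} {k : ℤ} (h : ℕ → ℕ) (hi : i < a)
    (hi' : i ∉ oppositeSupport a β k) :
    ∑ i ∈ oppositeSupport a β k, h i + h i ≤ ∑ i ∈ Finset.range a, h i := by
  rw [add_comm, ← Finset.sum_insert hi']
  refine Finset.sum_le_sum_of_subset (Finset.insert_subset (Finset.mem_range.2 hi)
    (Finset.filter_subset _ _))

theorem exists_max (D : CoverData a t p h β γ) : ∃ i₀ < a, (∀ k, γ k ≤ h i₀) ∧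
    (∀ j, β j ≤ h i₀) ∧ ∀ i < a, i ≠ i₀ → h i + h i₀ ≤ ∑ i ∈ Finset.range a, h i := by
  obtain ⟨i₀, hi₀, hmax⟩ := Finset.exists_max_image (Finset.range a) h
    ⟨0, Finset.mem_range.2 (by have := D.two_le_a; omega)⟩
  rw [Finset.mem_range] at hi₀
  refine ⟨i₀, hi₀, fun k => ?_, fun j => ?_, fun i hi hne => add_le_sum_range_of_ne h hi hi₀ hne⟩
  · rcases Nat.eq_zero_or_pos (γ k) with h0 | h0
    · omega
    · obtain ⟨i, hi⟩ := D.support_nonempty h0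
      exact (D.pair_support h0 hi).2.1.trans
        (hmax i (Finset.mem_range.2 (mem_oppositeSupport.1 hi).1))
  · rcases Nat.eq_zero_or_pos (β j) with h0 | h0
    · omega
    · obtain ⟨i, hi⟩ := D.symm.support_nonempty h0
      exact (D.symm.pair_support h0 hi).2.1.trans
        (hmax i (Finset.mem_range.2 (mem_oppositeSupport.1 hi).1))

/-- A window opposite to a nonempty `β j` carries less than `p`, and every fibre is at most the
largest hole count `h i₀`. If the total exceeded `t * p`, the two places next to the window would be
so large that their only nonempty opposite fibre is the one through `i₀`. These two opposite fibres
are adjacent, so one of them is also opposite through `i₀ ± 1`. -/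
theorem sum_right_le (D : CoverData a t p h β γ) : ∑ x ∈ Finset.range (a + t), γ x ≤ t * p := by
  by_contra hcon
  push Not at hcon
  have ha := D.two_le_a
  obtain ⟨t', rfl⟩ : ∃ t', t = t' + 2 := ⟨t - 2, by have := D.two_le_t; omega⟩
  obtain ⟨i₀, hi₀, hγ, -, hsum⟩ := D.exists_max
  have hlt := D.sum_lt
  have hi₀p := le_sum_range h hi₀
  obtain ⟨j, hj⟩ : ∃ j, 0 < β j := by
    by_contra h0
    push Not at h0
    have : ∀ k, γ k = 0 := fun k => by
      by_contra hk
      obtain ⟨i, -, hi⟩ := D.cover_left k (Nat.pos_of_ne_zero hk)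
      have := h0 (-k - i)
      omega
    simp [this] at hcon
  have hW := (D.symm.window_le hj).trans (support_sum_le a h γ j)
  rw [sum_range_eq_window_add D.periodic_right (-j), Finset.sum_range_succ',
    Finset.sum_range_succ'] at hcon
  have hrest : ∑ y ∈ Finset.range t', γ (-j + 1 + ((y + 1 + 1 : ℕ) : ℤ)) ≤ t' * p := by
    have := Finset.sum_le_sum (s := Finset.range t')
      (f := fun y => γ (-j + 1 + ((y + 1 + 1 : ℕ) : ℤ))) (g := fun _ => p)
      (fun y _ => (hγ _).trans (by omega))
    simpa using this
  have e : (t' + 2) * p = t' * p + 2 * p := by ring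
  simp only [Nat.cast_zero, add_zero, zero_add, Nat.cast_one] at hcon
  have h1 := hγ (-j + 1)
  have h2 := hγ (-j + 1 + 1)
  have huniq : ∀ k i, ∑ i ∈ Finset.range a, h i < γ k + h i₀ → i < a → 0 < β (-k - i) →
      i = i₀ := by
    intro k i hk hi hb
    by_contra hne
    have := hsum i hi hne
    have := (D.pair i hi _ k (by ring) hb (by omega)).2.1
    omega
  have hb : ∀ k, ∑ i ∈ Finset.range a, h i < γ k + h i₀ → 0 < β (-k - i₀) := by
    intro k hk
    obtain ⟨i, hi, hb⟩ := D.cover_left k (by omega)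
    rwa [huniq k i hk hi hb] at hb
  have hb1 := hb (-j + 1) (by omega)
  have hb2 := hb (-j + 1 + 1) (by omega)
  by_cases hi : i₀ + 1 < a
  · have := huniq (-j + 1) (i₀ + 1) (by omega) hi
      (by rwa [show -(-j + 1) - ((i₀ + 1 : ℕ) : ℤ) = -(-j + 1 + 1) - i₀ by push_cast; ring])
    omega
  · have := huniq (-j + 1 + 1) (i₀ - 1) (by omega) (by omega)
      (by rwa [show -(-j + 1 + 1) - ((i₀ - 1 : ℕ) : ℤ) = -(-j + 1) - i₀ by omega])
    omega

theorem exists_pos_of_window (D : CoverData a t p h β γ) {k : ℤ} (hk : 0 < γ k) :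
    ∃ y < t, 0 < β (-k + 1 + y) := by
  by_contra hcon
  push Not at hcon
  have hW := (D.window_le hk).trans (support_sum_le a h β k)
  have h0 : ∑ y ∈ Finset.range t, β (-k + 1 + y) = 0 :=
    Finset.sum_eq_zero fun y hy => by
      have := hcon y (Finset.mem_range.1 hy)
      omega
  have hc := D.crit
  rw [sum_range_eq_window_add D.periodic_left (-k), h0] at hc
  have := D.sum_right_le
  omega

/-- If the support is `{i₀}`, the pair bound `β + γ ≤ p` suffices; if it contains another `i`, then
`γ k ≤ h i`; if it omits `i₀`, the window sum loses `h i₀`. -/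
theorem window_add_le (D : CoverData a t p h β γ) {k : ℤ} (hk : 0 < γ k) {i₀ : ℕ} (hi₀ : i₀ < a)
    (hγ : γ k ≤ h i₀)
    (hsum : ∀ i < a, i ≠ i₀ → h i + h i₀ ≤ ∑ i ∈ Finset.range a, h i) :
    ∑ i ∈ Finset.range a, β (-k - i) + γ k + h i₀ ≤ ∑ i ∈ Finset.range a, h i + p := by
  have hW := D.window_le hk
  have hW' := hW.trans (support_sum_le a h β k)
  have hlt := D.sum_lt
  have hi₀p := le_sum_range h hi₀
  by_cases hmem : i₀ ∈ oppositeSupport a β k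
  · by_cases hex : ∃ i ∈ oppositeSupport a β k, i ≠ i₀
    · obtain ⟨i, hi, hne⟩ := hex
      have h1 := (D.pair_support hk hi).2.1
      have h2 := hsum i (mem_oppositeSupport.1 hi).1 hne
      omega
    · push Not at hex
      have hS : oppositeSupport a β k = {i₀} := by
        ext i
        rw [Finset.mem_singleton]
        exact ⟨hex i, by rintro rfl; exact hmem⟩
      rw [window_eq, hS, Finset.sum_singleton]
      have := (D.pair_support hk hmem).2.2.1
      omega
  · have := support_sum_add_le h hi₀ hmem
    omega

/-- If some window is small, then outside of it there are two nonempty fibres. -/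
theorem exists_two_pos_of_window (D : CoverData a t p h β γ) {k : ℤ} (hk : 0 < γ k)
    (hW : γ k + ∑ i ∈ Finset.range a, β (-k - i) ≤ p) :
    ∃ y y', y < y' ∧ y' < t ∧ 0 < β (-k + 1 + y) ∧ 0 < β (-k + 1 + y') := by
  obtain ⟨y₀, hy₀, hb₀⟩ := D.exists_pos_of_window hk
  by_contra hcon
  push Not at hcon
  have hz : ∀ y < t, y ≠ y₀ → β (-k + 1 + y) = 0 := by
    intro y hy hne
    by_contra h0
    rcases lt_or_gt_of_ne hne with hlt | hlt
    · have := hcon y y₀ hlt hy₀ (by omega)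
      omega
    · have := hcon y₀ y hlt hy hb₀
      omega
  obtain ⟨i₀, hi₀, hγ, hβ, hsum⟩ := D.exists_max
  have hc := D.crit
  -- With a single nonempty place `j` outside, the window at `k`, the window at `j` and the bound `h
  -- i₀` for the other `t - 1` places together contradict `crit`.
  set j : ℤ := -k + 1 + y₀ with hj
  have hw := D.symm.window_add_le hb₀ hi₀ (hβ j) hsum
  have hsumβ : ∑ y ∈ Finset.range t, β (-k + 1 + y) = β j :=
    Finset.sum_eq_single y₀ (fun y hy hne => hz y (Finset.mem_range.1 hy) hne)
      (fun hn => absurd (Finset.mem_range.2 hy₀) hn)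
  rw [sum_range_eq_window_add D.periodic_left (-k), hsumβ,
    sum_range_eq_window_add D.periodic_right (-j),
    ← Finset.add_sum_erase _ _ (Finset.mem_range.2 hy₀), show -j + 1 + (y₀ : ℤ) = k by
      rw [hj]; ring] at hc
  have hrest := Finset.sum_le_card_nsmul ((Finset.range t).erase y₀)
    (fun y : ℕ => γ (-j + 1 + y)) (h i₀) (fun y _ => hγ _)
  rw [Finset.card_erase_of_mem (Finset.mem_range.2 hy₀), Finset.card_range, smul_eq_mul] at hrest
  obtain ⟨t', rfl⟩ : ∃ t', t = t' + 2 := ⟨t - 2, by have := D.two_le_t; omega⟩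
  have hp := D.sum_lt
  have hi₀p := le_sum_range h hi₀
  have e1 : (t' + 2) * p = t' * p + 2 * p := by ring
  have e2 : (t' + 2 - 1) * h i₀ = t' * h i₀ + h i₀ := by
    rw [show t' + 2 - 1 = t' + 1 by omega]; ring
  have e3 : t' * h i₀ ≤ t' * p := Nat.mul_le_mul_left _ (by omega)
  omega

/-- A window that is large in spite of omitting `i` leaves no room for `h i' ≤ h i`. Hence supports
of large windows are comparable. -/
theorem upper_of_large (D : CoverData a t p h β γ) {k : ℤ} (hk : 0 < γ k)
    (hW : p < γ k + ∑ i ∈ Finset.range a, β (-k - i)) :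
    ∀ i < a, i ∉ oppositeSupport a β k → ∀ i' ∈ oppositeSupport a β k, h i < h i' := by
  intro i hi hni i' hi'
  have h1 := D.window_le hk
  have h2 := support_sum_add_le h hi hni
  have h3 := (D.pair_support hk hi').2.1
  have h4 := D.sum_lt
  omega

theorem two_le_card_of_large (D : CoverData a t p h β γ) {k : ℤ} (hk : 0 < γ k)
    (hW : p < γ k + ∑ i ∈ Finset.range a, β (-k - i)) : 2 ≤ (oppositeSupport a β k).card := by
  by_contra hcon
  have hpos := Finset.card_pos.2 (D.support_nonempty hk)
  obtain ⟨i, hi⟩ := Finset.card_eq_one.1 (show (oppositeSupport a β k).card = 1 by omega)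
  rw [window_eq, hi, Finset.sum_singleton] at hW
  have := (D.pair_support hk (by rw [hi]; exact Finset.mem_singleton_self i)).2.2.1
  omega

end CoverData

/-- A periodic subset of the integers that contains `t ≥ 2` consecutive places, such that all
differences of the set `S` of its places in the complementary window are periods of it, is
everything. -/
theorem forall_of_window_periods {P : ℤ → Prop} {a t : ℕ} {S : Finset ℕ} {o : ℤ}
    (hper : ∀ x, P (x + (a + t : ℕ)) ↔ P x) (ht : 2 ≤ t) (hS : ∀ i, i ∈ S ↔ i < a ∧ P (o - i))
    (hS2 : 2 ≤ S.card) (hJ : ∀ y < t, P (o + 1 + (y : ℕ)))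
    (hd : ∀ i ∈ S, ∀ i' ∈ S, ∀ x, P x → P (x + i' - i)) : ∀ i < a, i ∈ S := by
  classical
  by_contra hcon
  push Not at hcon
  obtain ⟨z, hz, hzS⟩ := hcon
  obtain ⟨i, hi, i', hi', hii'⟩ : ∃ i ∈ S, ∃ i' ∈ S, i < i' := by
    obtain ⟨u, hu, v, hv, huv⟩ := Finset.one_lt_card.1 (show 1 < S.card by omega)
    rcases lt_or_gt_of_ne huv with hlt | hlt
    exacts [⟨u, hu, v, hv, hlt⟩, ⟨v, hv, u, hu, hlt⟩]
  have hi'a := ((hS i').1 hi').1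
  have hex : ∃ y : ℕ, ¬ P (o + t + 1 + y) := by
    refine ⟨a - 1 - z, fun hP => hzS ((hS z).2 ⟨hz, ?_⟩)⟩
    rw [← hper]
    rwa [show o - (z : ℤ) + ((a + t : ℕ) : ℤ) = o + t + 1 + ((a - 1 - z : ℕ) : ℤ) by omega]
  have hmin := fun m => Nat.find_min hex (m := m)
  have hy := Nat.find_spec hex
  set y := Nat.find hex
  -- `o + t + 1 + y` is the first gap after the run of `t` places. Stepping back by the period `i' -
  -- i` must give a gap too, which can only lie before the run; so the period exceeds `t + y`.
  have hyd : ¬ P (o + t + 1 + y - (i' - i)) := fun hP => hy (by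
    have := hd i hi i' hi' _ hP
    rwa [show o + t + 1 + (y : ℤ) - (i' - i) + i' - i = o + t + 1 + y by ring] at this)
  have h1 : y < i' - i := by
    by_contra hle
    exact hmin (y - (i' - i)) (by omega) (by
      rwa [show o + t + 1 + ((y - (i' - i) : ℕ) : ℤ) = o + t + 1 + y - (i' - i) by omega])
  have h2 : t + y < i' - i := by
    by_contra hle
    refine hyd ?_
    have := hJ (t + y - (i' - i)) (by omega)
    rwa [show o + 1 + ((t + y - (i' - i) : ℕ) : ℤ) = o + t + 1 + y - (i' - i) by omega] at this
  -- The first two places of the run, moved by the period, land in the window one period on. Two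
  -- consecutive places in `S` make `1` a period.
  have hmem : ∀ u < 2, (a + t - 1 - u - (i' - i)) ∈ S := by
    intro u hu
    refine (hS _).2 ⟨by omega, ?_⟩
    have := hd i hi i' hi' _ (hJ u (by omega))
    rw [← hper]
    rwa [show o - ((a + t - 1 - u - (i' - i) : ℕ) : ℤ) + ((a + t : ℕ) : ℤ) =
      o + 1 + (u : ℕ) + i' - i by omega]
  have hstep : ∀ x, P x → P (x + 1) := by
    intro x hx
    have := hd _ (hmem 1 (by omega)) _ (hmem 0 (by omega)) x hx
    rwa [show x + ((a + t - 1 - 0 - (i' - i) : ℕ) : ℤ) - ((a + t - 1 - 1 - (i' - i) : ℕ) : ℤ) =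
      x + 1 by omega] at this
  have hall : ∀ n : ℕ, P (o + 1 + n) := by
    intro n
    induction n with
    | zero => exact hJ 0 (by omega)
    | succ n ih =>
      have := hstep _ ih
      rwa [show o + 1 + (n : ℤ) + 1 = o + 1 + ((n + 1 : ℕ) : ℤ) by push_cast; ring] at this
  apply hy
  have := hall (t + y)
  rwa [show o + 1 + ((t + y : ℕ) : ℤ) = o + t + 1 + y by push_cast; ring] at this

namespace CoverData

variable {a t p : ℕ} {h : ℕ → ℕ} {β γ : ℤ → ℕ}

/-- The smallest support `S` lies in all others, so for `i ∈ S` the map `x ↦ -i - x` exchanges the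
supports of `β` and `γ`. Taking `i` with the fewest holes, the sum of `β x + γ (-i - x)` over the
support of `β` is too small for `crit`. -/
theorem false_of_large_aux (D : CoverData a t p h β γ)
    (hγ : ∀ k, 0 < γ k → p < γ k + ∑ i ∈ Finset.range a, β (-k - i))
    (hβ : ∀ j, 0 < β j → p < β j + ∑ i ∈ Finset.range a, γ (-j - i))
    {k₀ : ℤ} (hk₀ : 0 < γ k₀)
    (hmin : ∀ k, 0 < γ k → (oppositeSupport a β k₀).card ≤ (oppositeSupport a β k).card)
    (hmin' : ∀ j, 0 < β j → (oppositeSupport a β k₀).card ≤ (oppositeSupport a γ j).card) :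
    False := by
  have ha := D.two_le_a
  have ht := D.two_le_t
  have hlt := D.sum_lt
  have hcrit := D.crit
  have hσ := D.two_le_card_of_large hk₀ (hγ k₀ hk₀)
  have hSsum := support_sum_le a h β k₀
  have hSmem : ∀ i, i ∈ oppositeSupport a β k₀ ↔ i < a ∧ 0 < β (-k₀ - i) :=
    fun i => mem_oppositeSupport
  have hub : ∀ i ∈ oppositeSupport a β k₀, ∀ k, 0 < γ k → 0 < β (-k - i) := by
    intro i hi k hk
    exact (mem_oppositeSupport.1 (subset_of_card_le_of_upper (Finset.filter_subset _ _)
      (Finset.filter_subset _ _) (D.upper_of_large hk₀ (hγ k₀ hk₀))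
      (D.upper_of_large hk (hγ k hk)) (hmin k hk) hi)).2
  have huc : ∀ i ∈ oppositeSupport a β k₀, ∀ j, 0 < β j → 0 < γ (-j - i) := by
    intro i hi j hj
    exact (mem_oppositeSupport.1 (subset_of_card_le_of_upper (Finset.filter_subset _ _)
      (Finset.filter_subset _ _) (D.upper_of_large hk₀ (hγ k₀ hk₀))
      (D.symm.upper_of_large hj (hβ j hj)) (hmin' j hj) hi)).2
  obtain ⟨i, hi, hleast⟩ := Finset.exists_min_image (oppositeSupport a β k₀) h
    (D.support_nonempty hk₀)
  have hia := (mem_oppositeSupport.1 hi).1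
  have hσh := (Finset.card_nsmul_le_sum _ _ _ hleast).trans hSsum
  rw [smul_eq_mul] at hσh
  have hT : ∑ x ∈ Finset.range (a + t), β x + ∑ x ∈ Finset.range (a + t), γ x =
      ∑ x ∈ Finset.range (a + t), (β x + γ (-i - x)) := by
    rw [Finset.sum_add_distrib, sum_range_reflect_of_periodic D.periodic_right]
  have hpair : ∀ x : ℤ, 0 < β x → β x ≤ h i ∧ γ (-i - x) ≤ h i ∧ β x + γ (-i - x) ≤ p ∧
      (2 * h i < p → 2 * (β x + γ (-i - x)) ≤ p + h i) ∧
      (3 * h i < p → 2 * (β x + γ (-i - x)) ≤ p) := by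
    intro x hx
    refine D.pair i hia x _ (by ring) hx ?_
    have := huc i hi x hx
    rwa [show -x - (i : ℤ) = -i - x by ring] at this
  let ind : ℤ → ℕ := fun x => if 0 < β x then 1 else 0
  have hind : ∀ x, ind (x + (a + t : ℕ)) = ind x := fun x => by
    simp only [ind, D.periodic_left]
  have hterm : ∀ x : ℤ, β x + γ (-i - x) ≤ 2 * h i * ind x := by
    intro x
    by_cases hx : 0 < β x
    · have := hpair x hx
      simp only [ind, if_pos hx]
      omega
    · have : γ (-i - x) = 0 := by
        by_contra h0
        have := hub i hi _ (Nat.pos_of_ne_zero h0)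
        rw [show -(-(i : ℤ) - x) - i = x by ring] at this
        exact hx this
      simp only [ind, if_neg hx]
      omega
  have hT2 := Finset.sum_le_sum (s := Finset.range (a + t)) (fun (x : ℕ) _ => hterm x)
  rw [← hT, ← Finset.mul_sum, sum_range_eq_window_add hind (-k₀)] at hT2
  have hσind : ∑ i ∈ Finset.range a, ind (-k₀ - i) = (oppositeSupport a β k₀).card := by
    simp only [ind, oppositeSupport, Finset.card_filter]
  rw [hσind] at hT2
  have hσh2 : 2 * h i ≤ (oppositeSupport a β k₀).card * h i := Nat.mul_le_mul_right _ hσ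
  have hindle : ∀ x, ind x ≤ 1 := fun x => by simp only [ind]; split_ifs <;> omega
  have hr : ∑ y ∈ Finset.range t, ind (-k₀ + 1 + y) ≤ t := by
    have := Finset.sum_le_card_nsmul (Finset.range t) (fun y : ℕ => ind (-k₀ + 1 + y)) 1
      (fun y _ => hindle _)
    simpa using this
  generalize hs : ∑ i ∈ Finset.range a, h i = s at *
  generalize hσe : (oppositeSupport a β k₀).card = σ at *
  -- With `r < t` nonempty places outside the window, `2 * h i ≤ s` and `σ * h i ≤ s` give a total
  -- of at most `s * (r + 2) ≤ s + t * p`.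
  have hJ : ∀ y < t, 0 < β (-k₀ + 1 + (y : ℕ)) := by
    intro y hy
    by_contra h0
    have hr' : ∑ y ∈ Finset.range t, ind (-k₀ + 1 + y) + 1 ≤ t := by
      rw [← Finset.add_sum_erase _ _ (Finset.mem_range.2 hy)]
      have := Finset.sum_le_card_nsmul ((Finset.range t).erase y)
        (fun y : ℕ => ind (-k₀ + 1 + y)) 1 (fun y _ => hindle _)
      rw [Finset.card_erase_of_mem (Finset.mem_range.2 hy), Finset.card_range] at this
      simp only [ind, if_neg h0] at this ⊢
      simp only [smul_eq_mul, mul_one] at this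
      omega
    generalize ∑ y ∈ Finset.range t, ind (-k₀ + 1 + y) = r at *
    have h1 : 2 * h i * r ≤ s * r := Nat.mul_le_mul_right _ (by omega)
    have h2 : s * (r + 1) ≤ p * t := Nat.mul_le_mul (by omega) hr'
    nlinarith
  generalize ∑ y ∈ Finset.range t, ind (-k₀ + 1 + y) = r at *
  have hrt : 2 * h i * r ≤ 2 * h i * t := Nat.mul_le_mul_left _ hr
  have hst : s * t ≤ p * t := Nat.mul_le_mul_right _ (by omega)
  have hσ3 : σ ≤ 3 := by
    by_contra hcon
    have h1 : 4 * h i ≤ σ * h i := Nat.mul_le_mul_right _ (by omega)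
    have h2 : 4 * h i * t ≤ s * t := Nat.mul_le_mul_right _ (by omega)
    have h3 : s * 2 ≤ s * t := Nat.mul_le_mul_left _ ht
    nlinarith
  -- Bounding `h i` by `s / σ` in the count forces `t * (σ - 2) < σ`.
  have hσt : σ = 2 ∨ σ = 3 ∧ t = 2 := by
    by_contra hcon
    have h0 : σ = 3 := by omega
    subst h0
    have h2 : 3 * h i * t ≤ s * t := Nat.mul_le_mul_right _ (by omega)
    have h3 : s * 3 ≤ s * t := Nat.mul_le_mul_left _ (by omega)
    nlinarith
  -- Passing to `γ` through `i'` and back through `i` makes `i' - i` a period of the support of `β`.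
  have hfull : ∀ i < a, i ∈ oppositeSupport a β k₀ :=
    forall_of_window_periods (P := fun x => 0 < β x) (fun x => by simp only [D.periodic_left]) ht
      hSmem (by omega) hJ (by
        intro i hi i' hi' x hx
        have := hub i hi _ (huc i' hi' x hx)
        rwa [show -(-x - (i' : ℤ)) - i = x + i' - i by ring] at this)
  have hσa : σ = a := by
    rw [← hσe, show oppositeSupport a β k₀ = Finset.range a from
      Finset.Subset.antisymm (Finset.filter_subset _ _)
        (fun i hi => hfull i (Finset.mem_range.1 hi)), Finset.card_range]
  have hall : ∀ x : ℕ, x < a + t → 0 < β x ∨ β x + γ (-i - x) = 0 := by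
    intro x _
    by_cases hx : 0 < β x
    · exact Or.inl hx
    · right
      have := hterm x
      simp only [ind, if_neg hx] at this
      omega
  rcases hσt with h2 | ⟨h3, h3'⟩
  -- For `σ = a = 2` one has `2 * h i < p`, so the sharper pair bound `(p + h i) / 2` applies to
  -- each of the `t + 2` places.
  · have hT3 := Finset.sum_le_card_nsmul (Finset.range (a + t))
      (fun x : ℕ => 2 * (β x + γ (-i - x))) (p + h i) (fun x hx => by
        rcases hall x (Finset.mem_range.1 hx) with hx | hx
        · refine (hpair x hx).2.2.2.1 ?_
          omega
        · simp only [hx]; omega)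
    rw [← Finset.mul_sum, ← hT, Finset.card_range, smul_eq_mul] at hT3
    obtain ⟨t', rfl⟩ : ∃ t', t = t' + 2 := ⟨t - 2, by omega⟩
    have h5 : t' * h i ≤ t' * p := Nat.mul_le_mul_left _ (by omega)
    rw [← hσa, h2] at hT3
    have e : (2 + (t' + 2)) * (p + h i) = t' * p + 4 * p + t' * h i + 4 * h i := by ring
    have e' : (t' + 2) * p = t' * p + 2 * p := by ring
    rw [h2] at hσh hσa
    rw [← hσa] at hcrit
    omega
  -- For `σ = a = 3`, `t = 2` the pair bound `p / 2` on five places gives `2 * s < p`, while the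
  -- bound `10 * h i` on the total gives `6 * p < 7 * s`.
  · have hT3 := Finset.sum_le_card_nsmul (Finset.range (a + t))
      (fun x : ℕ => 2 * (β x + γ (-i - x))) p (fun x hx => by
        rcases hall x (Finset.mem_range.1 hx) with hx | hx
        · refine (hpair x hx).2.2.2.2 ?_
          rw [h3] at hσh
          omega
        · simp only [hx]; omega)
    rw [← Finset.mul_sum, ← hT, Finset.card_range, smul_eq_mul] at hT3
    subst h3 h3' hσa
    have h6 : 2 * h i * (3 + r) ≤ 2 * h i * 5 := Nat.mul_le_mul_left _ (by omega)
    omega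

/-- It is impossible that all windows are large. -/
theorem exists_small_window (D : CoverData a t p h β γ) :
    (∃ k, 0 < γ k ∧ γ k + ∑ i ∈ Finset.range a, β (-k - i) ≤ p) ∨
    (∃ j, 0 < β j ∧ β j + ∑ i ∈ Finset.range a, γ (-j - i) ≤ p) := by
  by_contra hcon
  push Not at hcon
  obtain ⟨hγ, hβ⟩ := hcon
  have key : ∀ {f g : ℤ → ℕ}, (∃ k, 0 < g k) → ∃ k, 0 < g k ∧ ∀ k', 0 < g k' →
      (oppositeSupport a f k).card ≤ (oppositeSupport a f k').card := by
    intro f g hg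
    obtain ⟨k, hk⟩ := hg
    obtain ⟨k, hk, hmin⟩ := WellFounded.has_min
      (measure fun k => (oppositeSupport a f k).card).wf {k | 0 < g k} ⟨k, hk⟩
    exact ⟨k, hk, fun k' hk' => not_lt.1 (hmin k' hk')⟩
  have hβ0 : ∃ j, 0 < β j := by
    by_contra h0
    push Not at h0
    have h1 : ∑ x ∈ Finset.range (a + t), β x = 0 :=
      Finset.sum_eq_zero fun x _ => by have := h0 x; omega
    have h2 := D.crit
    have h3 := D.sum_right_le
    omega
  have hγ0 : ∃ k, 0 < γ k := by
    obtain ⟨j, hj⟩ := hβ0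
    obtain ⟨i, -, hi⟩ := D.cover_right j hj
    exact ⟨_, hi⟩
  obtain ⟨k, hk, hkmin⟩ := key (f := β) hγ0
  obtain ⟨j, hj, hjmin⟩ := key (f := γ) hβ0
  rcases le_total (oppositeSupport a β k).card (oppositeSupport a γ j).card with hle | hle
  · exact D.false_of_large_aux hγ hβ hk hkmin (fun j' hj' => hle.trans (hjmin j' hj'))
  · exact D.symm.false_of_large_aux hβ hγ hj hjmin (fun k' hk' => hle.trans (hkmin k' hk'))

end CoverData

/-! ### Excluding the covered case. -/

section Cover

variable {Γ : Type*} [AddCommGroup Γ] [DecidableEq Γ] [Fintype Γ]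

/-- Dropping `C k` and the window of `B` opposite to it costs at most `|Γ|`, so `A`, the rest of `B`
and the complement `M` of `-C` still form a linear pair. The covering of the two extreme places of
`B` forces both ends of `M` to be non-full, contrary to `full_end`. -/
theorem CoverData.false_of_small_window {a t : ℕ} {A : ℕ → Finset Γ} {B C : ℤ → Finset Γ}
    (hz : ∀ i < a, ∀ j k : ℤ, i + j + k = 0 → ∀ x ∈ A i, ∀ y ∈ B j, ∀ z ∈ C k, x + y + z ≠ 0)
    (D : CoverData a t (Fintype.card Γ) (fun i => Fintype.card Γ - (A i).card)
      (fun j => (B j).card) (fun k => (C k).card)) {k : ℤ} (hk : 0 < (C k).card)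
    (hW : (C k).card + ∑ i ∈ Finset.range a, (B (-k - i)).card ≤ Fintype.card Γ) : False := by
  classical
  obtain ⟨u, u', huu, hu', hbu, hbu'⟩ := D.exists_two_pos_of_window hk hW
  let Y : Finset ℕ := (Finset.range t).filter (fun y => 0 < (B (-k + 1 + (y : ℕ))).card)
  have hY : ∀ y, y ∈ Y ↔ y < t ∧ 0 < (B (-k + 1 + (y : ℕ))).card := by simp [Y]
  have huY : u ∈ Y := (hY u).2 ⟨by omega, hbu⟩
  have huY' : u' ∈ Y := (hY u').2 ⟨hu', hbu'⟩
  obtain ⟨y₁, hy₁, hmin⟩ := Finset.exists_min_image Y id ⟨u, huY⟩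
  obtain ⟨y₂, hy₂, hmax⟩ := Finset.exists_max_image Y id ⟨u, huY⟩
  have h1 := hmin u huY
  have h2 := hmax u' huY'
  simp only [id] at hmin hmax h1 h2
  obtain ⟨hy₁t, hb₁⟩ := (hY y₁).1 hy₁
  obtain ⟨hy₂t, hb₂⟩ := (hY y₂).1 hy₂
  obtain ⟨m, rfl⟩ : ∃ m, y₂ = y₁ + m := ⟨y₂ - y₁, by omega⟩
  obtain ⟨s, rfl⟩ : ∃ s, t = y₁ + (m + 1) + s := ⟨t - (y₁ + (m + 1)), by omega⟩
  set o : ℤ := -k + 1 + y₁ with ho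
  let M : ℕ → Finset Γ := fun e => Finset.univ \ (C (-(o + e))).image (fun x => -x)
  have hMc : ∀ e : ℕ, (M e).card + (C (-(o + e))).card = Fintype.card Γ := by
    intro e
    have := Finset.card_le_univ (C (-(o + e)))
    rw [Finset.card_univ_sdiff, Finset.card_image_of_injective _ neg_injective]
    omega
  have hMne : ∀ e : ℕ, 0 < (C (-(o + e))).card → M e ≠ Finset.univ := by
    intro e he hM
    have := hMc e
    rw [hM, Finset.card_univ] at this
    omega
  have hsumA := LinearPair.sum_left_add_holes A a
  have hcrit := D.crit
  have hβ0 : ∑ y ∈ Finset.range (y₁ + (m + 1) + s), (B (-k + 1 + (y : ℕ))).card =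
      ∑ j ∈ Finset.range (m + 1), (B (o + (j : ℕ))).card := by
    rw [Finset.sum_range_add, Finset.sum_range_add, Finset.sum_eq_zero, zero_add,
      Finset.sum_eq_zero (s := Finset.range s), add_zero]
    · refine Finset.sum_congr rfl fun j _ => ?_
      rw [show -k + 1 + ((y₁ + j : ℕ) : ℤ) = o + j by rw [ho]; push_cast; ring]
    · intro x hx
      rw [Finset.mem_range] at hx
      by_contra h0
      have := hmax (y₁ + (m + 1) + x) ((hY _).2 ⟨by omega, by omega⟩)
      omega
    · intro x hx
      rw [Finset.mem_range] at hx
      by_contra h0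
      have := hmin x ((hY _).2 ⟨by omega, by omega⟩)
      omega
  have hβ := sum_range_eq_window_add (f := fun j => (B j).card) D.periodic_left (-k)
  have hγ : ∑ x ∈ Finset.range (a + (y₁ + (m + 1) + s)), (C x).card = (C k).card +
      (∑ x ∈ Finset.range y₁, (C (k - 1 - (x : ℕ))).card +
      ∑ e ∈ Finset.range (a + m), (C (-(o + (e : ℕ)))).card +
      ∑ x ∈ Finset.range s, (C (k - 1 - ((y₁ + (a + m) + x : ℕ) : ℤ))).card) := by
    rw [← sum_range_reflect_of_periodic (f := fun k => (C k).card) D.periodic_right k,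
      show a + (y₁ + (m + 1) + s) = y₁ + (a + m) + s + 1 by ring, Finset.sum_range_succ',
      add_comm, Nat.cast_zero, sub_zero, Finset.sum_range_add, Finset.sum_range_add]
    congr 2
    · congr 1
      · refine Finset.sum_congr rfl fun x _ => ?_
        rw [show k - ((x + 1 : ℕ) : ℤ) = k - 1 - x by push_cast; ring]
      · refine Finset.sum_congr rfl fun x _ => ?_
        rw [show k - ((y₁ + x + 1 : ℕ) : ℤ) = -(o + x) by rw [ho]; push_cast; ring]
    · refine Finset.sum_congr rfl fun x _ => ?_
      rw [show k - ((y₁ + (a + m) + x + 1 : ℕ) : ℤ) = k - 1 - ((y₁ + (a + m) + x : ℕ) : ℤ) by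
        push_cast; ring]
  have hM : ∑ e ∈ Finset.range (a + m), (M e).card +
      ∑ e ∈ Finset.range (a + m), (C (-(o + (e : ℕ)))).card = (a + m) * Fintype.card Γ := by
    rw [← Finset.sum_add_distrib, Finset.sum_congr rfl (fun e _ => hMc e)]
    simp
  have hle1 := Finset.sum_le_card_nsmul (Finset.range y₁)
    (fun x : ℕ => (C (k - 1 - (x : ℕ))).card) _ (fun x _ => Finset.card_le_univ _)
  have hle2 := Finset.sum_le_card_nsmul (Finset.range s)
    (fun x : ℕ => (C (k - 1 - ((y₁ + (a + m) + x : ℕ) : ℤ))).card) _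
    (fun x _ => Finset.card_le_univ _)
  rw [Finset.card_range, smul_eq_mul] at hle1 hle2
  have e1 : (y₁ + (m + 1) + s) * Fintype.card Γ = y₁ * Fintype.card Γ + m * Fintype.card Γ +
    Fintype.card Γ + s * Fintype.card Γ := by ring
  have e2 : (a + m) * Fintype.card Γ = a * Fintype.card Γ + m * Fintype.card Γ := by ring
  have L : LinearPair a m A (fun j => B (o + (j : ℕ))) M :=
    { two_le := D.two_le_a
      one_le := by omega
      holes := D.sum_lt
      head := by simpa using Finset.card_pos.1 hb₁
      last := by
        have := Finset.card_pos.1 hb₂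
        rwa [show -k + 1 + ((y₁ + m : ℕ) : ℤ) = o + m by rw [ho]; push_cast; ring] at this
      sub := by
        intro i hi j _ w hw
        obtain ⟨x, hx, y, hy, rfl⟩ := Finset.mem_add.1 hw
        refine Finset.mem_sdiff.2 ⟨Finset.mem_univ _, fun hn => ?_⟩
        obtain ⟨z, hzC, hzxy⟩ := Finset.mem_image.1 hn
        exact hz i hi _ _ (by push_cast; ring) x hx y hy z hzC (by rw [← hzxy, neg_add_cancel])
      small := by
        omega }
  have hend := L.full_end
  obtain ⟨i, hi, hci⟩ := D.cover_right o (by simpa using hb₁)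
  obtain ⟨i', hi', hci'⟩ := D.cover_right (o + m) (by
    rwa [show -k + 1 + ((y₁ + m : ℕ) : ℤ) = o + m by rw [ho]; push_cast; ring] at hb₂)
  have n1 : M i ≠ Finset.univ := hMne i (by rwa [show -(o + (i : ℤ)) = -o - i by ring])
  have n2 : M (m + i') ≠ Finset.univ := hMne _ (by
    rwa [show -(o + ((m + i' : ℕ) : ℤ)) = -(o + m) - i' by push_cast; ring])
  have h3 : i = 0 := by
    by_contra h0
    exact n1 (L.full_inner (by omega) (by omega))
  have h4 : m + i' = a + m - 1 := by
    by_contra h0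
    exact n2 (L.full_inner (by omega) (by omega))
  rw [h3] at n1
  rw [h4] at n2
  exact hend.elim n1 n2

/-- A critical configuration in which the first set has few holes cannot cover all fibres. -/
theorem CoverData.elim {a t : ℕ} {A : ℕ → Finset Γ} {B C : ℤ → Finset Γ}
    (hz : ∀ i < a, ∀ j k : ℤ, i + j + k = 0 → ∀ x ∈ A i, ∀ y ∈ B j, ∀ z ∈ C k, x + y + z ≠ 0)
    (D : CoverData a t (Fintype.card Γ) (fun i => Fintype.card Γ - (A i).card)
      (fun j => (B j).card) (fun k => (C k).card)) : False := by
  rcases D.exists_small_window with ⟨k, hk, hW⟩ | ⟨j, hj, hW⟩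
  · exact D.false_of_small_window hz hk hW
  · refine D.symm.false_of_small_window (fun i hi j k hijk x hx y hy z hz' => ?_) hj hW
    rw [add_right_comm]
    exact hz i hi k j (by rw [← hijk]; ring) x hx z hz' y hy

end Cover

/-! ### Trios: symmetries, maximality and the meaning of criticality. -/

section Trio

variable {G : Type*} [AddCommGroup G] {A B C : Set G}

theorem isTrio_iff : IsTrio A B C ↔ (∀ a ∈ A, ∀ b ∈ B, ∀ c ∈ C, a + b + c ≠ 0) ∧
    (A.Finite ∨ Aᶜ.Finite) ∧ (B.Finite ∨ Bᶜ.Finite) ∧ (C.Finite ∨ Cᶜ.Finite) := by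
  unfold IsTrio
  refine and_congr_left fun _ => ⟨fun h a ha b hb c hc h0 => h ?_, fun h h0 => ?_⟩
  · rw [← h0]
    exact Set.add_mem_add (Set.add_mem_add ha hb) hc
  · obtain ⟨x, ⟨a, ha, b, hb, rfl⟩, c, hc, hx⟩ := h0
    exact h a ha b hb c hc hx

theorem IsTrio.swap_right (h : IsTrio A B C) : IsTrio A C B := by
  rw [isTrio_iff] at h ⊢
  refine ⟨fun a ha b hb c hc => ?_, h.2.1, h.2.2.2, h.2.2.1⟩
  rw [add_right_comm]
  exact h.1 a ha c hc b hb

theorem IsTrio.swap_left (h : IsTrio A B C) : IsTrio B A C := by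
  rw [isTrio_iff] at h ⊢
  refine ⟨fun a ha b hb c hc => ?_, h.2.2.1, h.2.1, h.2.2.2⟩
  rw [add_comm a b]
  exact h.1 b hb a ha c hc

theorem IsMaximalTrio.swap_right (h : IsMaximalTrio A B C) : IsMaximalTrio A C B :=
  ⟨h.1.swap_right, fun A' C' B' ht hA hC hB => by
    obtain ⟨h1, h2, h3⟩ := h.2 A' B' C' ht.swap_right hA hB hC
    exact ⟨h1, h3, h2⟩⟩

theorem IsMaximalTrio.swap_left (h : IsMaximalTrio A B C) : IsMaximalTrio B A C :=
  ⟨h.1.swap_left, fun B' A' C' ht hB hA hC => by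
    obtain ⟨h1, h2, h3⟩ := h.2 A' B' C' ht.swap_left hA hB hC
    exact ⟨h2, h1, h3⟩⟩

theorem IsMaximalTrio.mem_right (h : IsMaximalTrio A B C) {x : G}
    (hx : ∀ a ∈ A, ∀ b ∈ B, a + b + x ≠ 0) : x ∈ C := by
  have ht := isTrio_iff.1 h.1
  have := (h.2 A B (insert x C) (isTrio_iff.2 ⟨fun a ha b hb c hc => ?_, ht.2.1, ht.2.2.1, ?_⟩)
    subset_rfl subset_rfl (Set.subset_insert _ _)).2.2
  · rw [← this]; exact Set.mem_insert _ _
  · rcases Set.mem_insert_iff.1 hc with rfl | hc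
    · exact hx a ha b hb
    · exact ht.1 a ha b hb c hc
  · rcases ht.2.2.2 with hf | hf
    · exact Or.inl (hf.insert x)
    · exact Or.inr (hf.subset (Set.compl_subset_compl.2 (Set.subset_insert _ _)))

theorem IsMaximalTrio.mem_left (h : IsMaximalTrio A B C) {x : G}
    (hx : ∀ b ∈ B, x + b ∈ A + B) : x ∈ A := by
  refine h.swap_left.swap_right.mem_right fun b hb c hc h0 => ?_
  obtain ⟨a', ha', b', hb', hab⟩ := hx b hb
  refine (isTrio_iff.1 h.1).1 a' ha' b' hb' c hc ?_
  simp only at hab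
  rw [hab, ← h0]
  abel

theorem IsMaximalTrio.right_eq (h : IsMaximalTrio A B C) : C = (-(A + B))ᶜ := by
  ext x
  constructor
  · rintro hx ⟨a, ha, b, hb, hab⟩
    exact (isTrio_iff.1 h.1).1 a ha b hb x hx (by
      simp only at hab
      rw [hab, neg_add_cancel])
  · intro hx
    refine h.mem_right fun a ha b hb h0 => hx ?_
    exact ⟨a, ha, b, hb, eq_neg_of_add_eq_zero_left h0⟩

theorem TrioSimilar.trans {A₁ B₁ C₁ A₂ B₂ C₂ : Set G} (h : TrioSimilar A B C A₁ B₁ C₁)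
    (h' : TrioSimilar A₁ B₁ C₁ A₂ B₂ C₂) : TrioSimilar A B C A₂ B₂ C₂ :=
  Relation.ReflTransGen.trans h h'

theorem trioSimilar_swap_right (A B C : Set G) : TrioSimilar A B C A C B :=
  Relation.ReflTransGen.single (TrioMove.swapRight A B C)

theorem trioSimilar_swap_left (A B C : Set G) : TrioSimilar A B C B A C :=
  Relation.ReflTransGen.single (TrioMove.swapLeft A B C)

theorem trioSimilar_shift (g : G) (A B C : Set G) :
    TrioSimilar A B C (g +ᵥ A) ((-g) +ᵥ B) C :=
  Relation.ReflTransGen.single (TrioMove.shift g A B C)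

theorem trioSimilar_vadd (g₁ g₂ : G) (A B C : Set G) :
    TrioSimilar A B C (g₁ +ᵥ A) (g₂ +ᵥ B) (-(g₁ + g₂) +ᵥ C) := by
  have h1 := trioSimilar_shift g₁ A B C
  have h2 := (trioSimilar_swap_left (g₁ +ᵥ A) ((-g₁) +ᵥ B) C).trans
    (trioSimilar_swap_right _ _ _)
  have h3 := trioSimilar_shift (g₁ + g₂) ((-g₁) +ᵥ B) C (g₁ +ᵥ A)
  have h4 := (trioSimilar_swap_right ((g₁ + g₂) +ᵥ (-g₁) +ᵥ B) (-(g₁ + g₂) +ᵥ C)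
    (g₁ +ᵥ A)).trans (trioSimilar_swap_left _ _ _)
  rw [vadd_vadd, show g₁ + g₂ + -g₁ = g₂ by abel] at h3 h4
  exact ((h1.trans h2).trans h3).trans h4

theorem IsTrio.vadd (h : IsTrio A B C) (g₁ g₂ : G) :
    IsTrio (g₁ +ᵥ A) (g₂ +ᵥ B) (-(g₁ + g₂) +ᵥ C) := by
  rw [isTrio_iff] at h ⊢
  have key : ∀ (g : G) (S : Set G), S.Finite ∨ Sᶜ.Finite →
      (g +ᵥ S).Finite ∨ (g +ᵥ S)ᶜ.Finite := by
    rintro g S (hS | hS)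
    · exact Or.inl (hS.vadd_set)
    · right
      rw [← Set.vadd_set_compl]
      exact hS.vadd_set
  refine ⟨?_, key _ _ h.2.1, key _ _ h.2.2.1, key _ _ h.2.2.2⟩
  rintro _ ⟨a, ha, rfl⟩ _ ⟨b, hb, rfl⟩ _ ⟨c, hc, rfl⟩ h0
  refine h.1 a ha b hb c hc ?_
  simp only [vadd_eq_add] at h0
  rw [← h0]
  abel

theorem IsPureChord.swap_right {H : AddSubgroup G} (h : IsPureChord H A C B) :
    IsPureChord H A B C := by
  obtain ⟨ht, R, hR, X, Y, Z, hXYZ, hs, h⟩ := h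
  exact ⟨ht.swap_right, R, hR, X, Y, Z, hXYZ, (trioSimilar_swap_right A B C).trans hs, h⟩

theorem IsImpureChord.swap_right {H : AddSubgroup G} (h : IsImpureChord H A C B) :
    IsImpureChord H A B C := by
  obtain ⟨ht, R, hR, X, Y, Z, hXYZ, hs, h⟩ := h
  exact ⟨ht.swap_right, R, hR, X, Y, Z, hXYZ, (trioSimilar_swap_right A B C).trans hs, h⟩

theorem not_subset_coset_of_cosetClosure_eq_univ (hA : cosetClosure A = Set.univ)
    {H : AddSubgroup G} (hH : H < ⊤) (g : G) : ¬ A ⊆ g +ᵥ (H : Set G) := by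
  intro hsub
  have : cosetClosure A ⊆ g +ᵥ (H : Set G) := Set.sInter_subset_of_mem ⟨hsub, H, g, rfl⟩
  rw [hA] at this
  refine hH.ne ((AddSubgroup.eq_top_iff' H).2 fun x => ?_)
  obtain ⟨y, hy, hxy⟩ := this (Set.mem_univ (g + x))
  simp only [vadd_eq_add, add_right_inj] at hxy
  rwa [← hxy]

theorem nonempty_of_not_subset_coset {H : AddSubgroup G} (h : ∀ g : G, ¬ A ⊆ g +ᵥ (H : Set G)) :
    A.Nonempty := by
  rw [Set.nonempty_iff_ne_empty]
  rintro rfl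
  exact h 0 (Set.empty_subset _)

omit [AddCommGroup G] in
theorem ncard_lt_of_ereal_sub_pos {X Y Z : Set G} (hX : X.Finite) (hY : Y.Finite)
    (h : 0 < (X.encard : EReal) + (Y.encard : EReal) - (Z.encard : EReal)) :
    Z.Finite ∧ Z.ncard < X.ncard + Y.ncard := by
  have hZ : Z.Finite := by
    by_contra hZ
    rw [Set.not_finite] at hZ
    rw [hZ.encard_eq] at h
    simp at h
  refine ⟨hZ, ?_⟩
  rw [← hX.cast_ncard_eq, ← hY.cast_ncard_eq, ← hZ.cast_ncard_eq] at h
  have h1 := EReal.sub_pos.1 h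
  exact_mod_cast h1

theorem ncard_neg_add_compl (h : IsMaximalTrio A B C) : Cᶜ.ncard = (A + B).ncard := by
  rw [h.right_eq, compl_compl, Set.ncard_neg]

theorem IsCriticalTrio.card_lt [Finite G] (h : IsCriticalTrio A B C) :
    Nat.card G < A.ncard + B.ncard + C.ncard := by
  have h2 := h.2
  have hA := Set.ncard_add_ncard_compl A
  have hB := Set.ncard_add_ncard_compl B
  have hC := Set.ncard_add_ncard_compl C
  unfold trioDeficiency at h2
  split_ifs at h2
  · have := (ncard_lt_of_ereal_sub_pos A.toFinite B.toFinite h2).2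
    omega
  · have := (ncard_lt_of_ereal_sub_pos A.toFinite C.toFinite h2).2
    omega
  · have := (ncard_lt_of_ereal_sub_pos B.toFinite C.toFinite h2).2
    omega

/-- By maximality `|A + B|` is the size of the complement of `C`, so positive deficiency is a
small-sumset inequality for the two sets other than the largest. -/
theorem IsCriticalTrio.infinite_cases [Infinite G] (hmax : IsMaximalTrio A B C)
    (h : IsCriticalTrio A B C) (hA : A.Finite) (hAne : A.Nonempty) :
    (B.Finite ∧ (A + B).ncard < A.ncard + B.ncard) ∨
      (C.Finite ∧ (A + C).ncard < A.ncard + C.ncard) := by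
  have h2 := h.2
  rw [← ncard_neg_add_compl hmax, ← ncard_neg_add_compl hmax.swap_right]
  have ht := isTrio_iff.1 h.1
  -- Two cofinite sets in an infinite group have a sumset meeting `-a`.
  have hnot : B.Finite ∨ C.Finite := by
    by_contra hcon
    push Not at hcon
    have hB := ht.2.2.1.resolve_left hcon.1
    have hC := ht.2.2.2.resolve_left hcon.2
    obtain ⟨a, ha⟩ := hAne
    have hfin : (Bᶜ ∪ (fun b => -a - b) ⁻¹' Cᶜ).Finite :=
      hB.union (hC.preimage (sub_right_injective.injOn))
    obtain ⟨b, hb⟩ := hfin.infinite_compl.nonempty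
    simp only [Set.mem_compl_iff, Set.mem_union, Set.mem_preimage, not_or, not_not] at hb
    exact ht.1 a ha b hb.1 _ hb.2 (by abel)
  unfold trioDeficiency at h2
  split_ifs at h2 with h3 h4
  · have hB : B.Finite := by
      rcases hnot with hB | hC
      · exact hB
      · exact Set.finite_of_encard_le_coe (k := C.ncard) (by rw [hC.cast_ncard_eq]; exact h3.2)
    exact Or.inl ⟨hB, (ncard_lt_of_ereal_sub_pos hA hB h2).2⟩
  · have hC : C.Finite := by
      rcases hnot with hB | hC
      · exact Set.finite_of_encard_le_coe (k := B.ncard) (by rw [hB.cast_ncard_eq]; exact h4.2)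
      · exact hC
    exact Or.inr ⟨hC, (ncard_lt_of_ereal_sub_pos hA hC h2).2⟩
  -- If `A` were the largest, all three sets would be finite, but the complement of `A` is infinite.
  · exfalso
    have hlt : B.Finite ∧ C.Finite := by
      rcases le_total B.encard C.encard with hle | hle
      · have h5 : ¬ A.encard ≤ C.encard := fun h5 => h3 ⟨h5, hle⟩
        have hC : C.Finite := Set.finite_of_encard_le_coe (k := A.ncard) (by
          rw [hA.cast_ncard_eq]; exact (not_le.1 h5).le)
        exact ⟨Set.finite_of_encard_le_coe (k := C.ncard) (by rw [hC.cast_ncard_eq]; exact hle), hC⟩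
      · have h5 : ¬ A.encard ≤ B.encard := fun h5 => h4 ⟨h5, hle⟩
        have hB : B.Finite := Set.finite_of_encard_le_coe (k := A.ncard) (by
          rw [hA.cast_ncard_eq]; exact (not_le.1 h5).le)
        exact ⟨hB, Set.finite_of_encard_le_coe (k := B.ncard) (by rw [hB.cast_ncard_eq]; exact hle)⟩
    have := (ncard_lt_of_ereal_sub_pos hlt.1 hlt.2 h2).1
    exact hA.infinite_compl this

end Trio

/-! ### Fibres over the cosets of `H`. -/

section Fibers

variable {G : Type*} [AddCommGroup G] (H : AddSubgroup G) [Fintype H]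

open Classical in
/-- The part of `X` in the coset `g + n • r + H`, translated into `H`. -/
noncomputable def cosetFiber (g r : G) (X : Set G) (n : ℤ) : Finset H :=
  Finset.univ.filter (fun x => g + n • r + (x : G) ∈ X)

variable {H}

theorem mem_cosetFiber {g r : G} {X : Set G} {n : ℤ} {x : H} :
    x ∈ cosetFiber H g r X n ↔ g + n • r + (x : G) ∈ X := by
  classical
  simp [cosetFiber]

theorem exists_of_cosetFiber_nonempty {g r : G} {X : Set G} {n : ℤ}
    (h : (cosetFiber H g r X n).Nonempty) : ∃ x ∈ X, x - g - n • r ∈ H := by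
  obtain ⟨y, hy⟩ := h
  refine ⟨_, mem_cosetFiber.1 hy, ?_⟩
  rw [show g + n • r + (y : G) - g - n • r = y by abel]
  exact y.2

theorem cosetFiber_nonempty_of_mem {g r : G} {X : Set G} {n : ℤ} {x : G} (hx : x ∈ X)
    (h : x - g - n • r ∈ H) : (cosetFiber H g r X n).Nonempty :=
  ⟨⟨_, h⟩, mem_cosetFiber.2 (by
    rwa [show g + n • r + (x - g - n • r) = x by abel])⟩

theorem cosetFiber_eq_univ_iff {g r : G} {X : Set G} {n : ℤ} :
    cosetFiber H g r X n = Finset.univ ↔ ∀ x, x - g - n • r ∈ H → x ∈ X := by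
  rw [Finset.eq_univ_iff_forall]
  constructor
  · intro h x hx
    have := mem_cosetFiber.1 (h ⟨_, hx⟩)
    rwa [show g + n • r + (x - g - n • r) = x by abel] at this
  · intro h y
    refine mem_cosetFiber.2 (h _ ?_)
    rw [show g + n • r + (y : G) - g - n • r = y by abel]
    exact y.2

theorem cosetFiber_add_subset [DecidableEq H] {g g' r : G} {X Y : Set G} {i j : ℤ} :
    cosetFiber H g r X i + cosetFiber H g' r Y j ⊆ cosetFiber H (g + g') r (X + Y) (i + j) := by
  intro z hz
  obtain ⟨x, hx, y, hy, rfl⟩ := Finset.mem_add.1 hz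
  refine mem_cosetFiber.2 ⟨_, mem_cosetFiber.1 hx, _, mem_cosetFiber.1 hy, ?_⟩
  simp only [AddSubgroup.coe_add, add_smul]
  abel

/-- Only the sizes are periodic: `N • r` need not vanish, so the fibre itself is translated inside
`H`. -/
theorem card_cosetFiber_add (g r : G) (X : Set G) (n : ℤ) {N : ℕ} (hN : N • r ∈ H) :
    (cosetFiber H g r X (n + N)).card = (cosetFiber H g r X n).card := by
  classical
  have : (cosetFiber H g r X (n + N)).image ((⟨N • r, hN⟩ : H) + ·) = cosetFiber H g r X n := by
    ext y
    rw [Finset.mem_image, mem_cosetFiber]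
    constructor
    · rintro ⟨x, hx, rfl⟩
      rw [mem_cosetFiber] at hx
      convert hx using 1
      simp only [AddSubgroup.coe_add, add_smul, natCast_zsmul]
      abel
    · intro hy
      refine ⟨y - ⟨N • r, hN⟩, mem_cosetFiber.2 ?_, by abel⟩
      convert hy using 1
      simp only [AddSubgroup.coe_sub, add_smul, natCast_zsmul]
      abel
  rw [← this, Finset.card_image_of_injective _ (add_right_injective _)]

theorem ncard_eq_sum_cosetFiber {g r : G} {X : Set G} {L : ℕ}
    (hr : ∀ e : ℕ, 0 < e → e < L → e • r ∉ H) (hX : ∀ x ∈ X, ∃ n < L, x - g - n • r ∈ H) :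
    X.ncard = ∑ n ∈ Finset.range L, (cosetFiber H g r X n).card := by
  classical
  let f : ℕ → Finset G := fun n => (cosetFiber H g r X n).image (fun x : H => g + n • r + (x : G))
  have hf : ∀ n, (f n).card = (cosetFiber H g r X n).card := fun n =>
    Finset.card_image_of_injective _ fun x y hxy => Subtype.ext (add_left_cancel hxy)
  have hmem : ∀ n x, x ∈ f n → x ∈ X ∧ x - g - n • r ∈ H := by
    intro n x hx
    obtain ⟨y, hy, rfl⟩ := Finset.mem_image.1 hx
    rw [mem_cosetFiber, natCast_zsmul] at hy
    refine ⟨hy, ?_⟩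
    rw [show g + n • r + (y : G) - g - n • r = y by abel]
    exact y.2
  have hne : ∀ n n', n < n' → n' < L → ∀ x, x - g - n • r ∈ H → x - g - n' • r ∉ H := by
    intro n n' hlt hL x hx hx'
    refine hr (n' - n) (by omega) (by omega) ?_
    have := H.sub_mem hx hx'
    obtain ⟨e, rfl⟩ : ∃ e, n' = n + e := ⟨n' - n, by omega⟩
    rw [Nat.add_sub_cancel_left]
    convert this using 1
    rw [add_smul]
    abel
  have hXS : X = ((Finset.range L).biUnion f : Finset G) := by
    ext x
    simp only [Finset.coe_biUnion, Set.mem_iUnion, Finset.mem_coe, Finset.mem_range, exists_prop]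
    constructor
    · intro hx
      obtain ⟨n, hn, h⟩ := hX x hx
      refine ⟨n, hn, Finset.mem_image.2 ⟨⟨_, h⟩, mem_cosetFiber.2 ?_, ?_⟩⟩
      · rw [natCast_zsmul]
        simpa [show g + n • r + (x - g - n • r) = x by abel] using hx
      · simp only
        abel
    · rintro ⟨n, -, hx⟩
      exact (hmem n x hx).1
  rw [hXS, Set.ncard_coe_finset, Finset.card_biUnion, ← hXS]
  · exact Finset.sum_congr rfl fun n _ => hf n
  · intro n hn n' hn' hnn'
    refine Finset.disjoint_left.2 fun x hx hx' => ?_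
    have hn := Finset.mem_range.1 hn
    have hn' := Finset.mem_range.1 hn'
    rcases lt_or_gt_of_ne hnn' with hlt | hlt
    · exact hne n n' hlt hn' x (hmem n x hx).2 (hmem n' x hx').2
    · exact hne n' n hlt hn x (hmem n' x hx').2 (hmem n x hx).2

end Fibers

/-! ### From full sumsets to chords. -/

section Chords

variable {G : Type*} [AddCommGroup G] {H : AddSubgroup G} {A B C : Set G} {r d g : G} {a m : ℕ}

theorem mk_eq_add_nsmul_iff {x d r : G} {i : ℕ} :
    (QuotientAddGroup.mk x : G ⧸ H) = QuotientAddGroup.mk d + i • QuotientAddGroup.mk r ↔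
      x - d - i • r ∈ H := by
  rw [show (QuotientAddGroup.mk d + i • QuotientAddGroup.mk r : G ⧸ H) =
    QuotientAddGroup.mk (d + i • r) from rfl, eq_comm, QuotientAddGroup.eq]
  rw [show -(d + i • r) + x = x - d - i • r by abel]

theorem mem_cosetRun_mk {x d r : G} {k : ℕ} :
    x ∈ cosetRun (QuotientAddGroup.mk d : G ⧸ H) (QuotientAddGroup.mk r) k ↔
      ∃ i ≤ k, x - d - i • r ∈ H := by
  simp only [cosetRun, Set.mem_ofPred_eq, mk_eq_add_nsmul_iff]

/-- Filling up the cosets of `A` does not enlarge `A + B`, so maximality says that they are already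
full. -/
theorem eq_cosetRun_of_full (hmax : IsMaximalTrio A B C) (ha : 1 ≤ a)
    (hA : ∀ x ∈ A, ∃ i < a, x - d - i • r ∈ H) (hB : ∀ x ∈ B, ∃ j < m + 1, x - g - j • r ∈ H)
    (hfull : ∀ x, ∀ e < a + m, x - (d + g) - e • r ∈ H → x ∈ A + B) :
    A = cosetRun (QuotientAddGroup.mk d : G ⧸ H) (QuotientAddGroup.mk r) (a - 1) := by
  ext x
  rw [mem_cosetRun_mk]
  constructor
  · intro hx
    obtain ⟨i, hi, h⟩ := hA x hx
    exact ⟨i, by omega, h⟩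
  · rintro ⟨i, hi, h⟩
    refine hmax.mem_left fun b hb => ?_
    obtain ⟨j, hj, h'⟩ := hB b hb
    refine hfull _ (i + j) (by omega) ?_
    convert H.add_mem h h' using 1
    rw [add_smul]
    abel

theorem isPureChord_of_full (hmax : IsMaximalTrio A B C)
    (hR : IsGeneratingCoset H (QuotientAddGroup.mk r)) (ha : 2 ≤ a) (hm : 1 ≤ m)
    (hA : ∀ x ∈ A, ∃ i < a, x - d - i • r ∈ H) (hB : ∀ x ∈ B, ∃ j < m + 1, x - g - j • r ∈ H)
    (hfull : ∀ x, ∀ e < a + m, x - (d + g) - e • r ∈ H → x ∈ A + B)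
    (hC : ∀ g : G, ¬ C ⊆ g +ᵥ (H : Set G)) : IsPureChord H A B C := by
  refine ⟨hmax.1, _, hR, A, B, C, hmax.1, Relation.ReflTransGen.refl,
    ⟨_, a - 1, by omega, eq_cosetRun_of_full hmax (by omega) hA hB hfull⟩,
    ⟨QuotientAddGroup.mk g, m, by omega, ?_⟩, hmax.right_eq, fun ⟨g, hg⟩ => hC g hg⟩
  have := eq_cosetRun_of_full (a := m + 1) (m := a - 1) hmax.swap_left (by omega) hB
    (fun x hx => by
      obtain ⟨i, hi, h⟩ := hA x hx
      exact ⟨i, by omega, h⟩)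
    (fun x e he h => by
      rw [add_comm B A]
      rw [add_comm g d] at h
      exact hfull x e (by omega) h)
  simpa using this

/-- As for a full sumset, but with the head exempt: every coset of `A` after its head only
contributes to positions `e > 0`. -/
theorem union_eq_cosetRun_of_full (hmax : IsMaximalTrio A B C) (ha : 1 ≤ a)
    (hA : ∀ x ∈ A, ∃ i < a, x - d - i • r ∈ H) (hB : ∀ x ∈ B, ∃ j < m + 1, x - g - j • r ∈ H)
    (hfull : ∀ x, ∀ e, 0 < e → e < a + m → x - (d + g) - e • r ∈ H → x ∈ A + B) :
    (H : Set G) ∪ (-d +ᵥ A) = cosetRun (0 : G ⧸ H) (QuotientAddGroup.mk r) (a - 1) := by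
  ext x
  rw [← QuotientAddGroup.mk_zero, mem_cosetRun_mk, Set.mem_union, Set.mem_vadd_set_iff_neg_vadd_mem,
    neg_neg, vadd_eq_add]
  simp only [sub_zero, SetLike.mem_coe]
  constructor
  · rintro (hx | hx)
    · exact ⟨0, by omega, by simpa using hx⟩
    · obtain ⟨i, hi, h⟩ := hA _ hx
      exact ⟨i, by omega, by simpa using h⟩
  · rintro ⟨i, hi, h⟩
    rcases Nat.eq_zero_or_pos i with rfl | hi0
    · left; simpa using h
    · right
      refine hmax.mem_left fun b hb => ?_
      obtain ⟨j, hj, h'⟩ := hB b hb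
      refine hfull _ (i + j) (by omega) (by omega) ?_
      convert H.add_mem h h' using 1
      rw [add_smul]
      abel

theorem isImpureChord_of_full (hmax : IsMaximalTrio A B C)
    (hR : IsGeneratingCoset H (QuotientAddGroup.mk r)) (ha : 2 ≤ a) (hm : 1 ≤ m)
    (hA : ∀ x ∈ A, ∃ i < a, x - d - i • r ∈ H) (hB : ∀ x ∈ B, ∃ j < m + 1, x - g - j • r ∈ H)
    (hfull : ∀ x, ∀ e, 0 < e → e < a + m → x - (d + g) - e • r ∈ H → x ∈ A + B)
    (hA0 : ∃ x ∈ A, x - d ∈ H) (hB0 : ∃ x ∈ B, x - g ∈ H)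
    (hnot : ∃ x, x - (d + g) ∈ H ∧ x ∉ A + B)
    (hC : ∀ g : G, ¬ C ⊆ g +ᵥ (H : Set G)) : IsImpureChord H A B C := by
  have hCeq := hmax.right_eq
  have hCeq' : -(-d + -g) +ᵥ C = (-((-d +ᵥ A) + (-g +ᵥ B)))ᶜ := by
    rw [hCeq, Set.vadd_set_compl]
    congr 1
    ext x
    rw [Set.mem_vadd_set_iff_neg_vadd_mem, neg_neg, vadd_eq_add, Set.mem_neg, Set.mem_neg]
    constructor
    · rintro ⟨y, hy, z, hz, h⟩
      refine ⟨_, Set.vadd_mem_vadd_set hy, _, Set.vadd_mem_vadd_set hz, ?_⟩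
      simp only [vadd_eq_add] at h ⊢
      rw [show -d + y + (-g + z) = -d + -g + (y + z) by abel, h]
      abel
    · rintro ⟨_, ⟨y, hy, rfl⟩, _, ⟨z, hz, rfl⟩, h⟩
      refine ⟨y, hy, z, hz, ?_⟩
      simp only [vadd_eq_add] at h ⊢
      rw [neg_add, ← h]
      abel
  refine ⟨hmax.1, _, hR, -d +ᵥ A, -g +ᵥ B, -(-d + -g) +ᵥ C, hmax.1.vadd _ _,
    trioSimilar_vadd _ _ _ _ _, ⟨a - 1, by omega, ?_⟩, ⟨m, by omega, ?_⟩, by rw [hCeq'],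
    ?_, ?_, ?_, ?_⟩
  · exact union_eq_cosetRun_of_full hmax (by omega) hA hB hfull
  · have := union_eq_cosetRun_of_full (a := m + 1) (m := a - 1) hmax.swap_left (by omega) hB
      (fun x hx => by
        obtain ⟨i, hi, h⟩ := hA x hx
        exact ⟨i, by omega, h⟩)
      (fun x e he0 he h => by
        rw [add_comm B A]
        rw [add_comm g d] at h
        exact hfull x e he0 (by omega) h)
    simpa using this
  · by_contra hcon
    rw [Set.not_nonempty_iff_eq_empty, Set.sdiff_eq_empty] at hcon
    refine hC (-d + -g) ?_
    rwa [← Set.vadd_set_subset_vadd_set_iff (a := -(-d + -g)), neg_vadd_vadd]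
  · obtain ⟨x, hx, h⟩ := hA0
    refine ⟨-d + x, Set.vadd_mem_vadd_set hx, ?_⟩
    rw [SetLike.mem_coe, neg_add_eq_sub]
    exact h
  · obtain ⟨x, hx, h⟩ := hB0
    refine ⟨-g + x, Set.vadd_mem_vadd_set hx, ?_⟩
    rw [SetLike.mem_coe, neg_add_eq_sub]
    exact h
  · obtain ⟨x, hx, h⟩ := hnot
    have hxC : -x ∈ C := by
      rw [hCeq, Set.mem_compl_iff, Set.mem_neg, neg_neg]
      exact h
    refine ⟨-(-d + -g) + -x, Set.vadd_mem_vadd_set hxC, ?_⟩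
    rw [SetLike.mem_coe, ← H.neg_mem_iff]
    convert hx using 1
    abel

theorem IsGeneratingCoset.neg (hR : IsGeneratingCoset H (QuotientAddGroup.mk r : G ⧸ H)) :
    IsGeneratingCoset H (QuotientAddGroup.mk (-r) : G ⧸ H) := by
  refine ⟨hR.1, hR.2.1, ?_⟩
  rw [QuotientAddGroup.mk_neg, AddSubgroup.zmultiples_neg, hR.2.2]

/-- A maximal trio whose first two sets have linearly arranged supports, the first one with few
holes, and whose sumset is small, is a chord. -/
theorem chord_of_linear [Fintype H] (hmax : IsMaximalTrio A B C)
    (hR : IsGeneratingCoset H (QuotientAddGroup.mk r)) (ha : 2 ≤ a) (hm : 1 ≤ m)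
    (hr : ∀ e : ℕ, 0 < e → e < a + m → e • r ∉ H)
    (hA : ∀ x ∈ A, ∃ i < a, x - d - i • r ∈ H) (hB : ∀ x ∈ B, ∃ j < m + 1, x - g - j • r ∈ H)
    (hholes : ∑ i ∈ Finset.range a, (Fintype.card H - (cosetFiber H d r A i).card) <
      Fintype.card H)
    (hB0 : ∃ x ∈ B, x - g ∈ H) (hBm : ∃ x ∈ B, x - g - m • r ∈ H)
    (hsmall : (A + B).ncard < A.ncard + B.ncard)
    (hC : ∀ g : G, ¬ C ⊆ g +ᵥ (H : Set G)) : IsPureChord H A B C ∨ IsImpureChord H A B C := by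
  classical
  have hAB : ∀ x ∈ A + B, ∃ e < a + m, x - (d + g) - e • r ∈ H := by
    rintro _ ⟨x, hx, y, hy, rfl⟩
    obtain ⟨i, hi, h⟩ := hA x hx
    obtain ⟨j, hj, h'⟩ := hB y hy
    refine ⟨i + j, by omega, ?_⟩
    convert H.add_mem h h' using 1
    simp only [add_smul]
    abel
  have L : LinearPair a m (fun i => cosetFiber H d r A i) (fun j => cosetFiber H g r B j)
      (fun e => cosetFiber H (d + g) r (A + B) e) :=
    { two_le := ha
      one_le := hm
      holes := hholes
      head := by
        obtain ⟨x, hx, h⟩ := hB0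
        exact cosetFiber_nonempty_of_mem hx (by simpa using h)
      last := by
        obtain ⟨x, hx, h⟩ := hBm
        exact cosetFiber_nonempty_of_mem hx (by simpa using h)
      sub := fun i _ j _ => by
        rw [Nat.cast_add]
        exact cosetFiber_add_subset
      small := by
        rw [← ncard_eq_sum_cosetFiber hr hAB,
          ← ncard_eq_sum_cosetFiber (fun e he he' => hr e he (by omega)) hA,
          ← ncard_eq_sum_cosetFiber (fun e he he' => hr e he (by omega)) hB]
        exact hsmall }
  have hin : ∀ e, 0 < e → e < a + m - 1 → ∀ x, x - (d + g) - e • r ∈ H → x ∈ A + B := by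
    intro e he he' x hx
    exact cosetFiber_eq_univ_iff.1 (L.full_inner he he') x (by simpa using hx)
  by_cases h0 : ∀ x, x - (d + g) ∈ H → x ∈ A + B
  · by_cases h1 : ∀ x, x - (d + g) - (a + m - 1) • r ∈ H → x ∈ A + B
    · left
      refine isPureChord_of_full hmax hR ha hm hA hB (fun x e he hx => ?_) hC
      rcases Nat.eq_zero_or_pos e with rfl | he0
      · exact h0 x (by simpa using hx)
      · by_cases he1 : e = a + m - 1
        · exact h1 x (he1 ▸ hx)
        · exact hin e he0 (by omega) x hx
    · right
      push Not at h1
      -- Only the last coset of the sumset is incomplete. Reading both runs backwards, with step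
      -- `-r`, makes it the head.
      have key : ∀ (y u : G) (n i : ℕ), i ≤ n →
          y - (u + n • r) - (n - i) • (-r) = y - u - i • r := by
        intro y u n i hi
        obtain ⟨k, rfl⟩ := Nat.exists_eq_add_of_le hi
        rw [Nat.add_sub_cancel_left, add_smul, smul_neg]
        abel
      have hsum : d + (a - 1) • r + (g + m • r) = d + g + (a + m - 1) • r := by
        rw [show a + m - 1 = a - 1 + m by omega, add_smul]
        abel
      refine isImpureChord_of_full (r := -r) (d := d + (a - 1) • r) (g := g + m • r) hmax hR.neg
        ha hm (fun x hx => ?_) (fun x hx => ?_) (fun x e he0 he hx => ?_) ?_ ?_ ?_ hC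
      · obtain ⟨i, hi, h⟩ := hA x hx
        exact ⟨a - 1 - i, by omega, by rwa [key _ _ _ _ (by omega)]⟩
      · obtain ⟨j, hj, h⟩ := hB x hx
        exact ⟨m - j, by omega, by rwa [key _ _ _ _ (by omega)]⟩
      · obtain ⟨e', rfl⟩ : ∃ e', e = a + m - 1 - e' := ⟨a + m - 1 - e, by omega⟩
        by_cases he' : e' ≤ a + m - 1
        · rw [hsum, key _ _ _ _ he'] at hx
          rcases Nat.eq_zero_or_pos e' with rfl | he'0
          · exact h0 x (by simpa using hx)
          · exact hin e' he'0 (by omega) x hx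
        · omega
      · obtain ⟨x, hx, h⟩ := exists_of_cosetFiber_nonempty
          (L.nonempty_left (i := a - 1) (by omega))
        exact ⟨x, hx, by rwa [natCast_zsmul, sub_sub] at h⟩
      · obtain ⟨x, hx, h⟩ := hBm
        exact ⟨x, hx, by rwa [sub_sub] at h⟩
      · obtain ⟨x, hx, h⟩ := h1
        exact ⟨x, by rwa [hsum, ← sub_sub], h⟩
  · right
    have h1 := L.full_end.resolve_left (fun h => h0 fun x hx =>
      cosetFiber_eq_univ_iff.1 h x (by simpa using hx))
    push Not at h0
    refine isImpureChord_of_full hmax hR ha hm hA hB (fun x e he0 he hx => ?_) ?_ hB0 h0 hC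
    · by_cases he1 : e = a + m - 1
      · subst he1
        exact cosetFiber_eq_univ_iff.1 h1 x (by simpa using hx)
      · exact hin e he0 (by omega) x hx
    · obtain ⟨x, hx, h⟩ := exists_of_cosetFiber_nonempty (L.nonempty_left (i := 0) (by omega))
      exact ⟨x, hx, by simpa using h⟩

end Chords

/-! ### Assembling the proof. -/

section Main

variable {G : Type*} [AddCommGroup G] {H : AddSubgroup G} {A B C : Set G} {r d g : G} {a : ℕ}

/-- Trims the arc around `B` to its extreme occupied cosets, so that both ends are nonempty; they
differ because `B` is not inside one coset. -/
theorem chord_of_positions [Fintype H] {L : ℕ} (hmax : IsMaximalTrio A B C)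
    (hR : IsGeneratingCoset H (QuotientAddGroup.mk r)) (ha : 2 ≤ a)
    (hr : ∀ e : ℕ, 0 < e → e < a + L → e • r ∉ H)
    (hA : ∀ x ∈ A, ∃ i < a, x - d - i • r ∈ H) (hB : ∀ x ∈ B, ∃ j < L, x - g - j • r ∈ H)
    (hholes : ∑ i ∈ Finset.range a, (Fintype.card H - (cosetFiber H d r A i).card) <
      Fintype.card H)
    (hsmall : (A + B).ncard < A.ncard + B.ncard)
    (hBc : ∀ g : G, ¬ B ⊆ g +ᵥ (H : Set G)) (hC : ∀ g : G, ¬ C ⊆ g +ᵥ (H : Set G)) :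
    IsPureChord H A B C ∨ IsImpureChord H A B C := by
  classical
  let J : Finset ℕ := (Finset.range L).filter (fun j => ∃ x ∈ B, x - g - j • r ∈ H)
  have hJ : ∀ j, j ∈ J ↔ j < L ∧ ∃ x ∈ B, x - g - j • r ∈ H := by simp [J]
  have hJne : J.Nonempty := by
    obtain ⟨b, hb⟩ := nonempty_of_not_subset_coset hBc
    obtain ⟨j, hj, h⟩ := hB b hb
    exact ⟨j, (hJ j).2 ⟨hj, b, hb, h⟩⟩
  obtain ⟨j₁, hj₁, hmin⟩ := Finset.exists_min_image J id hJne
  obtain ⟨j₂, hj₂, hmaxj⟩ := Finset.exists_max_image J id hJne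
  simp only [id] at hmin hmaxj
  have h12 := hmin j₂ hj₂
  rw [hJ] at hj₁ hj₂
  have hshift : ∀ (x : G) (j : ℕ), j₁ ≤ j → x - (g + j₁ • r) - (j - j₁) • r = x - g - j • r := by
    intro x j hj
    obtain ⟨k, rfl⟩ := Nat.exists_eq_add_of_le hj
    rw [Nat.add_sub_cancel_left, add_smul]
    abel
  have hm : 1 ≤ j₂ - j₁ := by
    by_contra hcon
    refine hBc (g + j₁ • r) fun b hb => ?_
    obtain ⟨j, hj, h⟩ := hB b hb
    have hjJ := (hJ j).2 ⟨hj, b, hb, h⟩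
    have h3 := hmin j hjJ
    have h4 := hmaxj j hjJ
    have h5 : j = j₁ := by omega
    rw [Set.mem_vadd_set_iff_neg_vadd_mem, vadd_eq_add, SetLike.mem_coe, neg_add_eq_sub,
      ← sub_sub, ← h5]
    exact h
  refine chord_of_linear (g := g + j₁ • r) (m := j₂ - j₁) hmax hR ha hm
    (fun e he he' => hr e he (by omega)) hA (fun b hb => ?_) hholes ?_ ?_ hsmall hC
  · obtain ⟨j, hj, h⟩ := hB b hb
    have hjJ := (hJ j).2 ⟨hj, b, hb, h⟩
    have h3 := hmin j hjJ
    have h4 := hmaxj j hjJ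
    exact ⟨j - j₁, by omega, by rwa [hshift b j h3]⟩
  · obtain ⟨x, hx, h⟩ := hj₁.2
    exact ⟨x, hx, by rwa [← sub_sub]⟩
  · obtain ⟨x, hx, h⟩ := hj₂.2
    exact ⟨x, hx, by rwa [hshift x j₂ h12]⟩

theorem exists_zsmul_sub_mem (hR : IsGeneratingCoset H (QuotientAddGroup.mk r : G ⧸ H)) (x : G) :
    ∃ n : ℤ, x - n • r ∈ H := by
  have : (QuotientAddGroup.mk x : G ⧸ H) ∈ AddSubgroup.zmultiples (QuotientAddGroup.mk r : G ⧸ H) := by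
    rw [hR.2.2]; trivial
  obtain ⟨n, hn⟩ := AddSubgroup.mem_zmultiples_iff.1 this
  refine ⟨n, ?_⟩
  rw [← QuotientAddGroup.mk_zsmul, QuotientAddGroup.eq, neg_add_eq_sub] at hn
  exact hn

theorem nsmul_mem_iff_addOrderOf_dvd {e : ℕ} :
    e • r ∈ H ↔ addOrderOf (QuotientAddGroup.mk r : G ⧸ H) ∣ e := by
  rw [addOrderOf_dvd_iff_nsmul_eq_zero, ← QuotientAddGroup.mk_nsmul, QuotientAddGroup.eq_zero_iff]

theorem sum_holes_lt [Fintype H] (hnear : ((A + (H : Set G)) \ A).ncard < Fintype.card H)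
    (hrun : ∀ x, x ∈ A + (H : Set G) ↔ ∃ i < a, x - d - i • r ∈ H)
    (hr : ∀ e : ℕ, 0 < e → e < a → e • r ∉ H) (hsub : A ⊆ A + (H : Set G))
    (hfin : (A + (H : Set G)).Finite) :
    ∑ i ∈ Finset.range a, (Fintype.card H - (cosetFiber H d r A i).card) < Fintype.card H := by
  have h1 := ncard_eq_sum_cosetFiber (X := A + (H : Set G)) hr (fun x hx => (hrun x).1 hx)
  have h2 := ncard_eq_sum_cosetFiber (X := A) hr (fun x hx => (hrun x).1 (hsub hx))
  have hfull : ∀ i ∈ Finset.range a, (cosetFiber H d r (A + (H : Set G)) i).card =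
      Fintype.card H := by
    intro i hi
    rw [cosetFiber_eq_univ_iff.2, Finset.card_univ]
    intro x hx
    exact (hrun x).2 ⟨i, Finset.mem_range.1 hi, by simpa using hx⟩
  rw [Finset.sum_congr rfl hfull, Finset.sum_const, Finset.card_range, smul_eq_mul] at h1
  have h3 := LinearPair.sum_left_add_holes (fun i : ℕ => cosetFiber H d r A i) a
  have h4 := Set.ncard_sdiff_add_ncard_of_subset hsub hfin
  omega

theorem false_of_cover [Finite G] [Fintype H] {t : ℕ} (htrio : IsTrio A B C)
    (hcrit : IsCriticalTrio A B C)
    (hN : addOrderOf (QuotientAddGroup.mk r : G ⧸ H) = a + t)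
    (hpos : ∀ x, ∃ n < a + t, x - n • r ∈ H)
    (ha : 2 ≤ a) (ht : 2 ≤ t) (hA : ∀ x ∈ A, ∃ i < a, x - d - i • r ∈ H)
    (hholes : ∑ i ∈ Finset.range a, (Fintype.card H - (cosetFiber H d r A i).card) <
      Fintype.card H)
    (hB : ∀ g, ∃ i < a, ∃ b ∈ B, d + i • r + b - g ∈ H)
    (hC : ∀ g, ∃ i < a, ∃ c ∈ C, d + i • r + c - g ∈ H) : False := by
  classical
  have hr : ∀ e : ℕ, 0 < e → e < a + t → e • r ∉ H := by
    intro e he he' hmem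
    rw [nsmul_mem_iff_addOrderOf_dvd, hN] at hmem
    have := Nat.le_of_dvd he hmem
    omega
  have hNr : (a + t) • r ∈ H := by rw [nsmul_mem_iff_addOrderOf_dvd, hN]
  have hfree := (isTrio_iff.1 htrio).1
  -- The base points `d`, `0`, `-d` cancel, so positions with `i + j + k = 0` give fibres in `H`
  -- without zero sums.
  have hz : ∀ i < a, ∀ j k : ℤ, (i : ℤ) + j + k = 0 → ∀ x ∈ cosetFiber H d r A (i : ℕ),
      ∀ y ∈ cosetFiber H 0 r B j, ∀ z ∈ cosetFiber H (-d) r C k, x + y + z ≠ 0 := by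
    intro i _ j k hijk x hx y hy z hz h0
    rw [mem_cosetFiber] at hx hy hz
    refine hfree _ hx _ hy _ hz ?_
    have h1 : ((x : G) + y + z) = 0 := by
      have := congrArg (fun w : H => (w : G)) h0
      simpa using this
    have h2 : (i : ℤ) • r + j • r + k • r = 0 := by rw [← add_smul, ← add_smul, hijk, zero_smul]
    calc d + (i : ℤ) • r + (x : G) + (0 + j • r + y) + (-d + k • r + z)
        = ((i : ℤ) • r + j • r + k • r) + (x + y + z) := by abel
      _ = 0 := by rw [h1, h2, add_zero]
  have hposs : ∀ g x, ∃ n < a + t, x - g - n • r ∈ H := fun g x => hpos (x - g)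
  have hcardA := ncard_eq_sum_cosetFiber (fun e he he' => hr e he (by omega)) hA
  have hcardB := ncard_eq_sum_cosetFiber (X := B) hr (fun x _ => hposs 0 x)
  have hcardC := ncard_eq_sum_cosetFiber (X := C) hr (fun x _ => hposs (-d) x)
  have hcardG := ncard_eq_sum_cosetFiber (X := Set.univ) hr (fun x _ => hposs 0 x)
  have hfull : ∀ i ∈ Finset.range (a + t), (cosetFiber H 0 r (Set.univ : Set G) i).card =
      Fintype.card H := by
    intro i _
    rw [cosetFiber_eq_univ_iff.2 (fun _ _ => Set.mem_univ _), Finset.card_univ]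
  rw [Set.ncard_univ, Finset.sum_congr rfl hfull, Finset.sum_const, Finset.card_range,
    smul_eq_mul] at hcardG
  have hsumA := LinearPair.sum_left_add_holes (fun i : ℕ => cosetFiber H d r A i) a
  have hlt := hcrit.card_lt
  have e1 : (a + t) * Fintype.card H = a * Fintype.card H + t * Fintype.card H := by ring
  refine CoverData.elim hz (t := t)
    { two_le_a := ha
      two_le_t := ht
      sum_lt := hholes
      periodic_left := fun x => card_cosetFiber_add _ _ _ _ hNr
      periodic_right := fun x => card_cosetFiber_add _ _ _ _ hNr
      pair := fun i hi j k hijk hj hk => ?_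
      cover_left := fun k _ => ?_
      cover_right := fun j _ => ?_
      crit := by omega }
  · have hAi : (cosetFiber H d r A (i : ℕ)).Nonempty := by
      have := le_sum_range (fun i : ℕ => Fintype.card H - (cosetFiber H d r A i).card) hi
      rw [← Finset.card_pos]
      omega
    exact zero_free_card_bounds hAi (Finset.card_pos.1 hj) (Finset.card_pos.1 hk)
      (hz i hi j k hijk)
  · obtain ⟨i, hi, b, hb, h⟩ := hB (d - k • r)
    refine ⟨i, hi, Finset.card_pos.2 (cosetFiber_nonempty_of_mem hb ?_)⟩
    convert h using 1
    simp only [sub_smul, neg_smul, natCast_zsmul]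
    abel
  · obtain ⟨i, hi, c, hc, h⟩ := hC (-(j • r))
    refine ⟨i, hi, Finset.card_pos.2 (cosetFiber_nonempty_of_mem hc ?_)⟩
    convert h using 1
    simp only [sub_smul, neg_smul, natCast_zsmul]
    abel

/-- The cosets of `B` avoid the `a` consecutive positions opposite to the missed coset, hence lie
among the `t` positions starting at `g - d + r`. -/
theorem chord_of_uncovered [Finite G] [Fintype H] {t : ℕ} (hmax : IsMaximalTrio A B C)
    (hlt : Nat.card G < A.ncard + B.ncard + C.ncard)
    (hR : IsGeneratingCoset H (QuotientAddGroup.mk r))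
    (hN : addOrderOf (QuotientAddGroup.mk r : G ⧸ H) = a + t)
    (hpos : ∀ x, ∃ n < a + t, x - n • r ∈ H)
    (ha : 2 ≤ a) (hA : ∀ x ∈ A, ∃ i < a, x - d - i • r ∈ H)
    (hholes : ∑ i ∈ Finset.range a, (Fintype.card H - (cosetFiber H d r A i).card) <
      Fintype.card H)
    (hBc : ∀ g : G, ¬ B ⊆ g +ᵥ (H : Set G)) (hC : ∀ g : G, ¬ C ⊆ g +ᵥ (H : Set G))
    (hB : ∃ g, ∀ i < a, ∀ b ∈ B, d + i • r + b - g ∉ H) :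
    IsPureChord H A B C ∨ IsImpureChord H A B C := by
  obtain ⟨g, hg⟩ := hB
  have hNr : (a + t) • r ∈ H := by rw [nsmul_mem_iff_addOrderOf_dvd, hN]
  refine chord_of_positions (L := t) (g := g - d + r) hmax hR ha (fun e he he' hmem => ?_) hA
    (fun b hb => ?_) hholes ?_ hBc hC
  · rw [nsmul_mem_iff_addOrderOf_dvd, hN] at hmem
    have := Nat.le_of_dvd he hmem
    omega
  · obtain ⟨n, hn, h⟩ := hpos (b - (g - d))
    have h0 : n ≠ 0 := by
      rintro rfl
      refine hg 0 (by omega) b hb ?_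
      convert h using 1
      simp only [zero_smul]
      abel
    have h1 : n ≤ t := by
      by_contra hcon
      refine hg (a + t - n) (by omega) b hb ?_
      convert H.add_mem h hNr using 1
      obtain ⟨k, hk⟩ := Nat.exists_eq_add_of_le hn.le
      rw [hk, Nat.add_sub_cancel_left, add_smul]
      abel
    obtain ⟨j, rfl⟩ := Nat.exists_eq_succ_of_ne_zero h0
    refine ⟨j, by omega, ?_⟩
    convert h using 1
    rw [succ_nsmul]
    abel
  · have h1 := ncard_neg_add_compl hmax
    have h2 := Set.ncard_add_ncard_compl C
    omega

theorem chord_of_finite [Finite G] [Fintype H] (hmax : IsMaximalTrio A B C)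
    (hcrit : IsCriticalTrio A B C)
    (hR : IsGeneratingCoset H (QuotientAddGroup.mk r))
    (hBc : ∀ g : G, ¬ B ⊆ g +ᵥ (H : Set G)) (hCc : ∀ g : G, ¬ C ⊆ g +ᵥ (H : Set G))
    (ha : 2 ≤ a) (hrun : ∀ x, x ∈ A + (H : Set G) ↔ ∃ i < a, x - d - i • r ∈ H)
    (hsub : A ⊆ A + (H : Set G))
    (hnear : ((A + (H : Set G)) \ A).ncard < Fintype.card H)
    (hproper : 2 * Fintype.card H ≤ Aᶜ.ncard) :
    IsPureChord H A B C ∨ IsImpureChord H A B C := by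
  obtain ⟨N, hN⟩ : ∃ N, addOrderOf (QuotientAddGroup.mk r : G ⧸ H) = N := ⟨_, rfl⟩
  have hNpos : 0 < N := hN ▸ addOrderOf_pos _
  have hNr : N • r ∈ H := by rw [nsmul_mem_iff_addOrderOf_dvd, hN]
  have hr : ∀ e : ℕ, 0 < e → e < N → e • r ∉ H := by
    intro e he he' hmem
    rw [nsmul_mem_iff_addOrderOf_dvd, hN] at hmem
    have := Nat.le_of_dvd he hmem
    omega
  have hpos : ∀ x, ∃ n < N, x - n • r ∈ H := by
    intro x
    obtain ⟨n, hn⟩ := exists_zsmul_sub_mem hR x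
    have h0 := Int.emod_nonneg n (b := (N : ℤ)) (by omega)
    have h1 := Int.emod_lt_of_pos n (b := (N : ℤ)) (by omega)
    refine ⟨(n % N).toNat, by omega, ?_⟩
    rw [← natCast_zsmul, Int.toNat_of_nonneg h0]
    convert H.add_mem hn (H.zsmul_mem hNr (n / N)) using 1
    rw [← natCast_zsmul, smul_smul, sub_add, ← sub_smul]
    congr 2
    have := Int.emod_add_mul_ediv n N
    linarith
  -- Otherwise at most one coset lies outside `A + H`, and with fewer than `|H|` holes the
  -- complement of `A` has fewer than `2|H|` elements.
  have haN : a + 2 ≤ N := by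
    by_contra hcon
    have hle : ((A + (H : Set G))ᶜ).ncard ≤ Fintype.card H := by
      have hc : ∀ x ∈ (A + (H : Set G))ᶜ, ∃ n < 1, x - (d + (N - 1) • r) - n • r ∈ H := by
        intro x hx
        obtain ⟨n, hn, h⟩ := hpos (x - d)
        have : n = N - 1 := by
          by_contra hne
          exact hx ((hrun x).2 ⟨n, by omega, h⟩)
        subst this
        exact ⟨0, one_pos, by rw [zero_smul, sub_zero, ← sub_sub]; exact h⟩
      rw [ncard_eq_sum_cosetFiber (fun e he he' => by omega) hc, Finset.sum_range_one]
      exact Finset.card_le_univ _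
    have hunion : Aᶜ ⊆ (A + (H : Set G))ᶜ ∪ ((A + (H : Set G)) \ A) := by
      intro x hx
      by_cases h : x ∈ A + (H : Set G)
      · exact Or.inr ⟨h, hx⟩
      · exact Or.inl h
    have h1 := Set.ncard_le_ncard hunion (Set.toFinite _)
    have h2 := Set.ncard_union_le (A + (H : Set G))ᶜ ((A + (H : Set G)) \ A)
    omega
  obtain ⟨t, rfl⟩ : ∃ t, N = a + t := ⟨N - a, by omega⟩
  have hA : ∀ x ∈ A, ∃ i < a, x - d - i • r ∈ H := fun x hx => (hrun x).1 (hsub hx)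
  have hholes := sum_holes_lt hnear hrun (fun e he he' => hr e he (by omega))
    hsub (Set.toFinite _)
  have hlt := hcrit.card_lt
  by_cases hBcov : ∃ g, ∀ i < a, ∀ b ∈ B, d + i • r + b - g ∉ H
  · exact chord_of_uncovered hmax hlt hR hN hpos ha hA hholes hBc hCc hBcov
  by_cases hCcov : ∃ g, ∀ i < a, ∀ c ∈ C, d + i • r + c - g ∉ H
  · rcases chord_of_uncovered hmax.swap_right (by omega) hR hN hpos ha hA hholes hCc hBc hCcov
      with h | h
    · exact Or.inl h.swap_right
    · exact Or.inr h.swap_right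
  push Not at hBcov hCcov
  exact (false_of_cover hmax.1 hcrit hN hpos ha (by omega) hA hholes hBcov hCcov).elim

theorem nsmul_notMem_of_infinite [Infinite G] [Finite H]
    (hR : IsGeneratingCoset H (QuotientAddGroup.mk r : G ⧸ H)) {e : ℕ} (he : 0 < e) :
    e • r ∉ H := by
  intro hmem
  have hfin : IsOfFinAddOrder (QuotientAddGroup.mk r : G ⧸ H) :=
    isOfFinAddOrder_iff_nsmul_eq_zero.2 ⟨e, he, by
      rwa [← QuotientAddGroup.mk_nsmul, QuotientAddGroup.eq_zero_iff]⟩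
  have h1 : (AddSubgroup.zmultiples (QuotientAddGroup.mk r : G ⧸ H) : Set (G ⧸ H)).Finite :=
    hfin.finite_zmultiples
  rw [hR.2.2, AddSubgroup.coe_top] at h1
  have h2 : Finite (G ⧸ H) := Set.finite_univ_iff.1 h1
  have := Finite.of_addSubgroup_quotient H
  exact not_finite G

/-- In an infinite group `G / H` is infinite cyclic, so the finite set `B` occupies a bounded
interval and no wrap-around occurs. -/
theorem chord_of_finite_pair [Infinite G] [Fintype H] (hmax : IsMaximalTrio A B C)
    (hR : IsGeneratingCoset H (QuotientAddGroup.mk r))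
    (hBc : ∀ g : G, ¬ B ⊆ g +ᵥ (H : Set G)) (hCc : ∀ g : G, ¬ C ⊆ g +ᵥ (H : Set G))
    (ha : 2 ≤ a) (hA : ∀ x ∈ A, ∃ i < a, x - d - i • r ∈ H)
    (hholes : ∑ i ∈ Finset.range a, (Fintype.card H - (cosetFiber H d r A i).card) <
      Fintype.card H)
    (hB : B.Finite) (hsmall : (A + B).ncard < A.ncard + B.ncard) :
    IsPureChord H A B C ∨ IsImpureChord H A B C := by
  choose f hf using exists_zsmul_sub_mem hR
  obtain ⟨l, hl⟩ := (hB.image f).bddBelow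
  obtain ⟨u, hu⟩ := (hB.image f).bddAbove
  refine chord_of_positions (L := (u - l + 1).toNat) (g := l • r) hmax hR ha
    (fun e he _ => nsmul_notMem_of_infinite hR he) hA (fun b hb => ?_) hholes hsmall hBc hCc
  have h1 := hl (Set.mem_image_of_mem f hb)
  have h2 := hu (Set.mem_image_of_mem f hb)
  refine ⟨(f b - l).toNat, by omega, ?_⟩
  rw [← natCast_zsmul, Int.toNat_of_nonneg (by omega), sub_sub, ← add_smul, add_sub_cancel]
  exact hf b

end Main

theorem mainTheorem2 {G : Type*} [AddCommGroup G] (A B C : Set G)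
    (hmax : IsMaximalTrio A B C) (hcrit : IsCriticalTrio A B C)
    (hA : cosetClosure A = Set.univ) (hB : cosetClosure B = Set.univ)
    (hC : cosetClosure C = Set.univ)
    (hnear : ∃ (H : AddSubgroup G) (R : G ⧸ H),
      IsGeneratingCoset H R ∧ IsProperNearCosetSeq R A) :
    (∃ K : AddSubgroup G, IsPureChord K A B C) ∨ (∃ K : AddSubgroup G, IsImpureChord K A B C) := by
  obtain ⟨H, R, hR, ⟨⟨D, k, hrun⟩, hholes⟩, hproper⟩ := hnear
  obtain ⟨r, rfl⟩ := QuotientAddGroup.mk_surjective R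
  obtain ⟨d, rfl⟩ := QuotientAddGroup.mk_surjective D
  have hHfin : Finite H := hR.1.to_subtype
  have : Fintype H := Fintype.ofFinite H
  have hHcard : (H : Set G).encard = (Fintype.card H : ℕ∞) := by
    rw [← hR.1.cast_ncard_eq, ← Nat.card_eq_fintype_card, ← Nat.card_coe_set_eq]
    rfl
  have hAc := not_subset_coset_of_cosetClosure_eq_univ hA hR.2.1
  have hBc := not_subset_coset_of_cosetClosure_eq_univ hB hR.2.1
  have hCc := not_subset_coset_of_cosetClosure_eq_univ hC hR.2.1
  have hrun' : ∀ x, x ∈ A + (H : Set G) ↔ ∃ i < k + 1, x - d - i • r ∈ H := by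
    intro x
    rw [hrun, mem_cosetRun_mk]
    simp only [Nat.lt_succ_iff]
  have hsub : A ⊆ A + (H : Set G) := fun x hx => ⟨x, hx, 0, H.zero_mem, add_zero x⟩
  have hfin : (A + (H : Set G)).Finite := by
    have : A + (H : Set G) ⊆ ⋃ i ∈ Set.Iio (k + 1), (d + i • r) +ᵥ (H : Set G) := by
      intro x hx
      obtain ⟨i, hi, h⟩ := (hrun' x).1 hx
      refine Set.mem_iUnion₂.2 ⟨i, hi, ?_⟩
      rw [Set.mem_vadd_set_iff_neg_vadd_mem, vadd_eq_add, SetLike.mem_coe, neg_add_eq_sub, ← sub_sub]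
      exact h
    exact ((Set.finite_Iio (k + 1)).biUnion fun i _ => hR.1.vadd_set).subset this
  have hAfin := hfin.subset hsub
  have hk : 2 ≤ k + 1 := by
    by_contra hcon
    refine hAc d fun x hx => ?_
    obtain ⟨i, hi, h⟩ := (hrun' x).1 (hsub hx)
    have : i = 0 := by omega
    subst this
    rw [Set.mem_vadd_set_iff_neg_vadd_mem, vadd_eq_add, SetLike.mem_coe, neg_add_eq_sub]
    simpa using h
  have hnear : ((A + (H : Set G)) \ A).ncard < Fintype.card H := by
    rw [hHcard, ← (hfin.subset Set.sdiff_subset).cast_ncard_eq] at hholes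
    exact_mod_cast hholes
  have key : IsPureChord H A B C ∨ IsImpureChord H A B C := by
    rcases finite_or_infinite G with hG | hG
    · refine chord_of_finite hmax hcrit hR hBc hCc hk hrun' hsub hnear ?_
      rw [hHcard, ← (Set.toFinite Aᶜ).cast_ncard_eq] at hproper
      exact_mod_cast hproper
    · have hA' : ∀ x ∈ A, ∃ i < k + 1, x - d - i • r ∈ H := fun x hx => (hrun' x).1 (hsub hx)
      have hh := sum_holes_lt hnear hrun' (fun e he _ => nsmul_notMem_of_infinite hR he)
        hsub hfin
      rcases hcrit.infinite_cases hmax hAfin (nonempty_of_not_subset_coset hAc) with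
        ⟨hBf, hs⟩ | ⟨hCf, hs⟩
      · exact chord_of_finite_pair hmax hR hBc hCc hk hA' hh hBf hs
      · rcases chord_of_finite_pair hmax.swap_right hR hCc hBc hk hA' hh hCf hs with h | h
        · exact Or.inl h.swap_right
        · exact Or.inr h.swap_right
  exact key.imp (fun h => ⟨H, h⟩) (fun h => ⟨H, h⟩)
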